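/- **Conventions.** $\mathbb T$ is the unit circle, $\mathcal M(\mathbb T)$ the set of complex Borel measures on $\mathbb T$, and $\widehat\sigma(n)=\int_{\mathbb T}z^{-n}\,d\sigma(z)$ for $\sigma\in\mathcal M(\mathbb T)$, $n\in\mathbb Z$. A standard complex Gaussian sequence is a sequence $(g_n)_{n\ge 0}$ of independent complex random variables whose real and imaginary parts are independent centred real Gaussian variables of variance $1/2$. Let $X$ be a separable complex Banach space. * A Gaussian measure on $X$ is the distribution of the sum of an almost surely convergent series $\sum_{n\ge 0} g_n x_n$, where $x_n\in X$ and $(g_n)$ is a standard complex Gaussian sequence. It has full support if every non-empty open set has positive measure. * $X$ has cotype $2$ if there is a finite constant $C$ such that $\left(\sum_n\|x_n\|^2\right)^{1/2}\le C\,\mathbb E\left\|\sum_n g_nx_n\right\|$ for every finite sequence $(x_n)$ in $X$. * Let $\mathbf S\subset\ell^\infty(\mathbb Z_+)$. A measure $\sigma\in\mathcal M(\mathbb T)$ is $\mathbf S$-continuous if $(\widehat\sigma(n))_{n\ge 0}\in\mathbf S$. A set $D\subset\mathbb T$ is $\mathbf S$-small if for every positive $\mathbf S$-continuous measure $\sigma$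 there is a Borel set $\widetilde D\supset D$ with $\sigma(\widetilde D)=0$. * Let $T:X\to X$ preserve a Borel probability measure $\mu$, and let $V$ be the isometry $Vf=f\circ T$ of $L^2(\mu)$. For $f,g\in L^2(\mu)$ let $\sigma_{f,g}\in\mathcal M(\mathbb T)$ be the unique measure with $\widehat\sigma_{f,g}(n)=\langle V^nf,g\rangle_{L^2(\mu)}$ and $\widehat\sigma_{f,g}(-n)=\langle V^{*n}f,g\rangle_{L^2(\mu)}$ for all $n\ge 0$. Then $T$ is $\mathbf S$-mixing with respect to $\mu$ if $\sigma_{f,g}$ is $\mathbf S$-continuous for all $f,g\in L^2(\mu)$ with $\int f\,d\mu=\int g\,d\mu=0$. **Proposition.** Let $X$ be a separable complex Banach space of cotype $2$, let $\mathbf S$ be an arbitrary subset of $\ell^\infty(\mathbb Z_+)$, and let $T$ be a bounded linear operator on $X$. Assume that $T$ is $\mathbf S$-mixing with respect to some Gaussian measure on $X$ with full support (in particular $T$ preserves this measure). Then the $\mathbb T$-eigenvectors of $T$ are $\mathbf S$-perfectly spanning for analytic sets: for every analytic $\mathbf S$-small set $D\subset\mathbb T$, the linear span of $\bigcup_{\lambda\in\mathbb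 T\setminus D}\ker(T-\lambda)$ is dense in $X$. -/

import Mathlib

open MeasureTheory ProbabilityTheory Filter Topology
open scoped ENNReal NNReal

noncomputable section

namespace LinDyn

/-! ### Complex Gaussian variables, Gaussian measures, cotype 2 -/

/-- The standard complex Gaussian distribution on `ℂ`: real and imaginary parts are independent
centred real Gaussian variables of variance `1 / 2`. -/
def stdComplexGaussian : Measure ℂ :=
  ((gaussianReal 0 (1 / 2)).prod (gaussianReal 0 (1 / 2))).map Complex.measurableEquivRealProd.symm

/-- A standard complex Gaussian sequence on the probability space `(Ω, P)`: independent random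
variables, each having the standard complex Gaussian distribution. -/
def IsStdComplexGaussianSeq {Ω : Type*} [MeasurableSpace Ω] (P : Measure Ω) (g : ℕ → Ω → ℂ) :
    Prop :=
  (∀ n, HasLaw (g n) stdComplexGaussian P) ∧ iIndepFun g P

/-- `μ` is a (centred, complex) Gaussian measure on `X`: the distribution of the sum `ξ` of an
almost surely convergent series `∑ g n • x n`, where `g` is a standard complex Gaussian sequence
and `x n ∈ X`. (Taking `Ω : Type` is no restriction, since the distribution of the sum depends only
on the sequence `x`, and one may always use `Ω = ℕ → ℂ` with a product measure.) -/
def IsGaussianMeasure {X : Type*} [NormedAddCommGroup X] [NormedSpace ℂ X] [MeasurableSpace X]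
    (μ : Measure X) : Prop :=
  ∃ (Ω : Type) (_ : MeasurableSpace Ω) (P : Measure Ω) (_ : IsProbabilityMeasure P)
    (g : ℕ → Ω → ℂ) (x : ℕ → X) (ξ : Ω → X),
    IsStdComplexGaussianSeq P g ∧
    (∀ᵐ ω ∂P, Tendsto (fun N : ℕ => ∑ n ∈ Finset.range N, g n ω • x n) atTop (𝓝 (ξ ω))) ∧
    HasLaw ξ μ P

/-- `X` has cotype 2: `(∑ ‖x i‖ ^ 2) ^ (1/2) ≤ C * 𝔼 ‖∑ g i • x i‖` for some finite constant `C` and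
every finite sequence of vectors, the `g i` being independent standard complex Gaussian
variables (realised as the coordinates of a finite product space). -/
def HasCotypeTwo (X : Type*) [NormedAddCommGroup X] [NormedSpace ℂ X] : Prop :=
  ∃ C : ℝ, ∀ (n : ℕ) (x : Fin n → X),
    Real.sqrt (∑ i, ‖x i‖ ^ 2) ≤
      C * ∫ g : Fin n → ℂ, ‖∑ i, g i • x i‖ ∂(Measure.pi fun _ => stdComplexGaussian)

/-! ### Complex measures on the unit circle and their Fourier coefficients -/

instance instMeasurableSpaceCircle : MeasurableSpace Circle := borel Circle

instance instBorelSpaceCircle : BorelSpace Circle := ⟨rfl⟩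

/-- The Fourier coefficient `∫ z ^ (-n) dσ(z)` of a complex measure on the circle. -/
def fourierCoeffMeasure (σ : ComplexMeasure Circle) (n : ℤ) : ℂ :=
  σ.integral (fun z : Circle => ((z ^ (-n) : Circle) : ℂ)) (ContinuousLinearMap.mul ℝ ℂ)

/-- A complex measure has finite total variation. -/
theorem isFiniteMeasure_variation (σ : ComplexMeasure Circle) : IsFiniteMeasure σ.variation := by
  have h : σ.variation ≤ (ComplexMeasure.re σ).totalVariation +
      (ComplexMeasure.im σ).totalVariation := by
    refine VectorMeasure.variation_le_of_forall_enorm_le fun E _ => ?_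
    rw [Measure.add_apply]
    refine le_trans ?_ (add_le_add (SignedMeasure.enorm_le_totalVariation (ComplexMeasure.re σ) E)
      (SignedMeasure.enorm_le_totalVariation (ComplexMeasure.im σ) E))
    have h1 : ‖σ E‖ ≤ ‖(ComplexMeasure.re σ) E‖ + ‖(ComplexMeasure.im σ) E‖ := by
      exact Complex.norm_le_abs_re_add_abs_im (σ E)
    rw [← ofReal_norm, ← ofReal_norm, ← ofReal_norm, ← ENNReal.ofReal_add (norm_nonneg _)
      (norm_nonneg _)]
    exact ENNReal.ofReal_le_ofReal h1
  exact isFiniteMeasure_of_le _ h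

/-- The Fourier coefficients of a complex measure form a bounded sequence. -/
theorem memℓp_fourierCoeffMeasure (σ : ComplexMeasure Circle) :
    Memℓp (fun n : ℕ => fourierCoeffMeasure σ n) ∞ := by
  have := isFiniteMeasure_variation σ
  refine memℓp_infty ⟨1 * ‖ContinuousLinearMap.mul ℝ ℂ‖ * σ.variation.real Set.univ, ?_⟩
  rintro _ ⟨n, rfl⟩
  exact VectorMeasure.norm_integral_le_of_norm_le_const
    (Eventually.of_forall fun z => (Circle.norm_coe _).le)

/-- The positive part of the Fourier transformation, `σ ↦ (σ̂(n))_{n ≥ 0}`, from complex measures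
on the circle to bounded sequences. -/
def fourierPlus (σ : ComplexMeasure Circle) : lp (fun _ : ℕ => ℂ) ∞ :=
  ⟨fun n : ℕ => fourierCoeffMeasure σ n, memℓp_fourierCoeffMeasure σ⟩

/-- The family of all `S`-continuous measures. -/
def continuousMeasures (S : Set (lp (fun _ : ℕ => ℂ) ∞)) : Set (ComplexMeasure Circle) :=
  {σ | fourierPlus σ ∈ S}

/-- The complex measure `σ` is a positive measure. -/
def IsPositiveMeasure (σ : ComplexMeasure Circle) : Prop :=
  ∀ A : Set Circle, MeasurableSet A → 0 ≤ (σ A).re ∧ (σ A).im = 0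

/-- `D` is `B`-small: every positive measure `σ ∈ B` vanishes on some Borel set (depending on `σ`)
which contains `D`. -/
def IsSmall (B : Set (ComplexMeasure Circle)) (D : Set Circle) : Prop :=
  ∀ σ ∈ B, IsPositiveMeasure σ → ∃ D' : Set Circle, MeasurableSet D' ∧ D ⊆ D' ∧ σ D' = 0

/-! ### `S`-mixing -/

section Mixing

variable {X : Type*} [MeasurableSpace X]

/-- The Koopman operator `f ↦ f ∘ T` on `L²(μ)`. -/
def koopman {μ : Measure X} {T : X → X} (hT : MeasurePreserving T μ μ) :
    Lp ℂ 2 μ →L[ℂ] Lp ℂ 2 μ :=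
  (Lp.compMeasurePreservingₗᵢ ℂ T hT).toContinuousLinearMap

/-- The family of all measures `σ_{f,g}` on the circle, for `f, g ∈ L²(μ)` with integral zero:
`σ̂_{f,g}(n) = ⟨V ^ n f, g⟩` and `σ̂_{f,g}(-n) = ⟨V* ^ n f, g⟩` for `n ≥ 0`, where `V` is the Koopman
operator and `⟨f, g⟩ = ∫ f ḡ dμ` (which is `inner ℂ g f`). -/
def spectralFamily {μ : Measure X} {T : X → X} (hT : MeasurePreserving T μ μ) :
    Set (ComplexMeasure Circle) :=
  {σ | ∃ f g : Lp ℂ 2 μ, ∫ x, f x ∂μ = 0 ∧ ∫ x, g x ∂μ = 0 ∧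
    ∀ n : ℕ, fourierCoeffMeasure σ (n : ℤ) = inner ℂ g ((koopman hT ^ n) f) ∧
      fourierCoeffMeasure σ (-(n : ℤ)) =
        inner ℂ g ((ContinuousLinearMap.adjoint (koopman hT) ^ n) f)}

/-- `T` preserves `μ` and is `S`-mixing with respect to `μ`. -/
def IsSMixing (S : Set (lp (fun _ : ℕ => ℂ) ∞)) (T : X → X) (μ : Measure X) : Prop :=
  ∃ hT : MeasurePreserving T μ μ, spectralFamily hT ⊆ continuousMeasures S

end Mixing

/-! ### Linear operators -/

section Operators

variable {X : Type*} [NormedAddCommGroup X] [NormedSpace ℂ X]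

/-- `T` is `S`-mixing in the Gaussian sense: it is `S`-mixing with respect to some Gaussian
measure with full support. -/
def IsSMixingGaussian [MeasurableSpace X] (S : Set (lp (fun _ : ℕ => ℂ) ∞)) (T : X →L[ℂ] X) :
    Prop :=
  ∃ μ : Measure X, IsGaussianMeasure μ ∧ μ.IsOpenPosMeasure ∧ IsSMixing S T μ

/-- The `𝕋`-eigenvectors of `T` are `B`-perfectly spanning for analytic sets: for every analytic
`B`-small set `D`, the span of `⋃_{z ∈ 𝕋 ∖ D} ker (T - z)` is dense. -/
def IsPerfectlySpanningAnalytic (B : Set (ComplexMeasure Circle)) (T : X →L[ℂ] X) : Prop :=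
  ∀ D : Set Circle, AnalyticSet D → IsSmall B D →
    Dense (Submodule.span ℂ
      (⋃ z ∈ Dᶜ, {x : X | (T - (z : ℂ) • ContinuousLinearMap.id ℂ X) x = 0}) : Set X)

end Operators

end LinDyn

end

noncomputable section

namespace LinDyn

/-! ### Finite families of standard complex Gaussian variables -/

/-! By Hahn–Banach it suffices that a functional `y` vanishing on all eigenvectors with eigenvalue
in `𝕋 ∖ D` is zero. Gaussian measures have square-integrable functionals, so `y` is a vector `h` of
`L²(μ)`, on which `T` acts through the Koopman isometry `V`. Herglotz' theorem provides a measure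
`σ` on the circle with moments `⟨V ^ k h, h⟩`, and `exists_spectral_model` a contraction `J : L²(μ)
→ L²(σ)` with `J h = 1` that turns `V` into multiplication by `z`.

Cotype 2 makes `J` pointwise. If `μ` is the law of `∑ gₙ xₙ`, the operator `J` sends the `gₙ` to a
contractive family `φₙ` in `L²(σ)`, and the square function estimate
`HasCotypeTwo.exists_eLpNorm_le` bounds `∑ φₙ xₙ` by the Gaussian sum, so the series converges in
`L²(σ; X)` to some `E` with `y' ∘ E = J y'` almost everywhere for each functional `y'`. Since `J (y'
∘ T) = z · J y'`, it follows that `T (E z) = z • E z`, while `y (E z) = 1`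
(`exists_eigenvector_field`).

The measure `σ` is one of the spectral measures of `T`, hence `S`-continuous as it stands: no
structure on `S` is needed. Smallness gives a `σ`-null Borel set containing `D`, so for almost every
`z` the vector `E z` is an eigenvector off `D` and `y (E z) = 0 ≠ 1`. Therefore `σ = 0`, its mass
`‖h‖ ^ 2` is zero, and full support forces `y = 0`. -/

instance instIsProbabilityMeasureStdComplexGaussian : IsProbabilityMeasure stdComplexGaussian :=
  Measure.isProbabilityMeasure_map (by fun_prop)

theorem stdComplexGaussian_eq_map : stdComplexGaussian =
    ((gaussianReal 0 (1 / 2)).prod (gaussianReal 0 (1 / 2))).map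
      (Complex.equivRealProdCLM.symm : ℝ × ℝ →L[ℝ] ℂ) := rfl

instance instIsGaussianStdComplexGaussian : IsGaussian stdComplexGaussian := by
  rw [stdComplexGaussian_eq_map]; infer_instance

theorem charFunDual_stdComplexGaussian (L : StrongDual ℝ ℂ) :
    charFunDual stdComplexGaussian L =
      Complex.exp (-((L 1 ^ 2 + L Complex.I ^ 2 : ℝ) : ℂ) / 4) := by
  rw [stdComplexGaussian_eq_map, charFunDual_map, charFunDual_prod]
  have key : ∀ M : StrongDual ℝ ℝ, charFunDual (gaussianReal 0 (1 / 2)) M =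
      Complex.exp (-((M 1 ^ 2 : ℝ) : ℂ) / 4) := by
    intro M
    have hM : ∀ x, M x = x * M 1 := fun x => by
      rw [← smul_eq_mul, ← map_smul, smul_eq_mul, mul_one]
    rw [charFunDual_apply]
    have := charFun_gaussianReal (μ := 0) (v := 1 / 2) (M 1)
    rw [charFun_apply_real] at this
    convert this using 2
    · ext x; rw [hM]; push_cast; ring_nf
    · push_cast; ring
  have h1 : (Complex.equivRealProdCLM.symm (1, 0) : ℂ) = 1 := by
    apply Complex.ext <;> simp [Complex.equivRealProdCLM_symm_apply]
  have h2 : (Complex.equivRealProdCLM.symm (0, 1) : ℂ) = Complex.I := by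
    apply Complex.ext <;> simp [Complex.equivRealProdCLM_symm_apply]
  rw [key, key, ← Complex.exp_add]
  simp only [ContinuousLinearMap.comp_apply, ContinuousLinearMap.inl_apply,
    ContinuousLinearMap.inr_apply, ContinuousLinearEquiv.coe_coe, h1, h2]
  congr 1
  push_cast
  ring

/-- The law of a finite family of independent standard complex Gaussian variables. -/
abbrev gaussianPi (ι : Type*) [Fintype ι] : Measure (ι → ℂ) :=
  Measure.pi fun _ => stdComplexGaussian

section GaussianPi

variable {ι κ : Type*} [Fintype ι] [Fintype κ]

instance instIsGaussianGaussianPi : IsGaussian (gaussianPi ι) := by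
  have h := iIndepFun.hasGaussianLaw (P := gaussianPi ι) (X := fun (i : ι) (g : ι → ℂ) => g i)
    (fun i => HasLaw.hasGaussianLaw (μ := stdComplexGaussian)
      ⟨(measurable_pi_apply i).aemeasurable, (measurePreserving_eval (fun _ : ι => stdComplexGaussian) i).map_eq⟩)
    (iIndepFun_pi (X := fun (_ : ι) (z : ℂ) => z) fun _ => by fun_prop)
  have h2 := h.isGaussian_map
  simpa using h2

theorem charFunDual_gaussianPi [DecidableEq ι] (L : StrongDual ℝ (ι → ℂ)) :
    charFunDual (gaussianPi ι) L =
      Complex.exp (-((∑ i, (L (Pi.single i 1) ^ 2 + L (Pi.single i Complex.I) ^ 2) : ℝ) : ℂ) / 4) := by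
  rw [charFunDual_pi]
  simp_rw [charFunDual_stdComplexGaussian]
  rw [← Complex.exp_sum]
  congr 1
  push_cast
  rw [neg_div, Finset.sum_div, ← Finset.sum_neg_distrib]
  exact Finset.sum_congr rfl fun _ _ => neg_div _ _

theorem ofReal_sum_norm_sq (v : ι → ℂ) : ((∑ k, ‖v k‖ ^ 2 : ℝ) : ℂ) = star v ⬝ᵥ v := by
  simp [dotProduct, ← Complex.conj_mul']

theorem sum_norm_mulVec_sq_of_conjTranspose_mul_self [DecidableEq ι] {w : Matrix κ ι ℂ}
    (hw : w.conjTranspose * w = 1) (t : ι → ℂ) :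
    ∑ k, ‖w.mulVec t k‖ ^ 2 = ∑ i, ‖t i‖ ^ 2 := by
  have h : ((∑ k, ‖w.mulVec t k‖ ^ 2 : ℝ) : ℂ) = ((∑ i, ‖t i‖ ^ 2 : ℝ) : ℂ) := by
    rw [ofReal_sum_norm_sq, ofReal_sum_norm_sq, Matrix.star_mulVec, Matrix.dotProduct_mulVec,
      Matrix.vecMul_vecMul, hw, Matrix.vecMul_one]
  exact_mod_cast h

/-- A linear image of a standard complex Gaussian vector under a co-isometry is again standard. -/
theorem map_gaussianPi [DecidableEq ι] {w : Matrix κ ι ℂ} (hw : w.conjTranspose * w = 1) :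
    (gaussianPi κ).map (fun g i => ∑ k, w k i * g k) = gaussianPi ι := by
  classical
  let A : (κ → ℂ) →L[ℝ] (ι → ℂ) := LinearMap.toContinuousLinearMap
    { toFun := fun g i => ∑ k, w k i * g k
      map_add' := fun g h => by ext i; simp [mul_add, Finset.sum_add_distrib]
      map_smul' := fun c g => by ext i; simp [Finset.mul_sum, mul_left_comm] }
  have hA : ((fun g i => ∑ k, w k i * g k) : (κ → ℂ) → ι → ℂ) = A := rfl
  rw [hA]
  refine Measure.ext_of_charFunDual ?_
  ext L
  rw [charFunDual_map, charFunDual_gaussianPi, charFunDual_gaussianPi]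
  congr 4
  -- `L` is the real part of the complex linear form with coefficients `t`. The two quadratic
  -- exponents become `‖w t‖ ^ 2` and `‖t‖ ^ 2`, equal because `w` is an isometry.
  let t : ι → ℂ := fun i => ⟨L (Pi.single i 1), -L (Pi.single i Complex.I)⟩
  have hL : ∀ z, L z = (∑ i, t i * z i).re := by
    intro z
    have hz : z = ∑ i, ((z i).re • (Pi.single i 1 : ι → ℂ) +
        (z i).im • (Pi.single i Complex.I : ι → ℂ)) := by
      ext j
      simp [Finset.sum_apply, Pi.single_apply, Finset.sum_add_distrib, Complex.re_add_im]
    conv_lhs => rw [hz]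
    simp only [map_sum, map_add, map_smul, Complex.re_sum, Complex.mul_re, t, smul_eq_mul]
    exact Finset.sum_congr rfl fun i _ => by ring
  have h1 : ∀ i, L (Pi.single i 1) ^ 2 + L (Pi.single i Complex.I) ^ 2 = ‖t i‖ ^ 2 := by
    intro i
    rw [Complex.sq_norm, Complex.normSq_apply]
    simp only [t]; ring
  have h2 : ∀ k, (L.comp A) (Pi.single k 1) ^ 2 + (L.comp A) (Pi.single k Complex.I) ^ 2 =
      ‖w.mulVec t k‖ ^ 2 := by
    intro k
    have h3 : ∀ c, (L.comp A) (Pi.single k c) = (w.mulVec t k * c).re := by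
      intro c
      rw [ContinuousLinearMap.comp_apply, hL]
      congr 1
      have : ∀ i, A (Pi.single k c) i = w k i * c := by
        intro i
        change ∑ j, w j i * (Pi.single k c : κ → ℂ) j = _
        simp [Pi.single_apply]
      simp_rw [this, Matrix.mulVec, dotProduct, Finset.sum_mul]
      exact Finset.sum_congr rfl fun i _ => by ring
    rw [h3, h3, Complex.sq_norm, Complex.normSq_apply]
    simp; ring
  simp_rw [h1, h2]
  exact sum_norm_mulVec_sq_of_conjTranspose_mul_self hw t

/-- The law is symmetric: this is `map_gaussianPi` for the matrix `-1`. -/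
theorem integral_dual_gaussianPi (L : StrongDual ℝ (ι → ℂ)) : ∫ g, L g ∂gaussianPi ι = 0 := by
  classical
  have h := map_gaussianPi (w := -(1 : Matrix ι ι ℂ)) (by simp)
  have h1 : (fun (g : ι → ℂ) i => ∑ k, (-(1 : Matrix ι ι ℂ)) k i * g k) = fun g => -g := by
    ext g i; simp [Matrix.one_apply]
  rw [h1] at h
  have h2 : ∫ g, L g ∂gaussianPi ι = - ∫ g, L g ∂gaussianPi ι := by
    conv_lhs => rw [← h]
    rw [integral_map (by fun_prop) (by fun_prop), ← integral_neg]
    simp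
  linarith

variable {X : Type*} [NormedAddCommGroup X] [NormedSpace ℂ X]

theorem memLp_sum_smul_gaussianPi (x : ι → X) (p : ℝ≥0∞) (hp : p ≠ ∞) :
    MemLp (fun g : ι → ℂ => ∑ i, g i • x i) p (gaussianPi ι) := by
  have : MemLp (id : (ι → ℂ) → (ι → ℂ)) p (gaussianPi ι) := IsGaussian.memLp_id _ p hp
  refine memLp_finsetSum _ fun i _ => ?_
  have h2 : MemLp (fun g : ι → ℂ => g i) p (gaussianPi ι) :=
    (ContinuousLinearMap.proj (R := ℝ) (φ := fun _ : ι => ℂ) i).comp_memLp' this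
  exact ((ContinuousLinearMap.id ℂ ℂ).smulRight (x i)).comp_memLp' h2

/-- Integrability of Gaussian vectors, in the following quantitative form: the second moment is
controlled by a quantile of the norm. -/
theorem exists_lintegral_enorm_sq_gaussianPi_le [MeasurableSpace X] [BorelSpace X]
    [SecondCountableTopology X] [CompleteSpace X] :
    ∃ K : ℝ≥0∞, K ≠ ∞ ∧ ∀ (ι : Type) [Fintype ι] (x : ι → X) (a : ℝ), 0 < a →
      3 / 4 ≤ gaussianPi ι {g | ‖∑ i, g i • x i‖ ≤ a} →
      ∫⁻ g, ‖∑ i, g i • x i‖ₑ ^ 2 ∂gaussianPi ι ≤ K * ENNReal.ofReal (a ^ 2) := by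
  -- Any level strictly between `1/2` and `1` would do. Fernique's bound depends on this level alone
  -- once the norm is scaled by `a`, so `K` serves all index types and all vectors.
  set c : ℝ≥0∞ := 3 / 4 with hc
  have hc_real : c = ENNReal.ofReal (3 / 4) := by
    rw [hc, ENNReal.ofReal_div_of_pos (by norm_num)]; norm_num
  have hc2 : 2⁻¹ < c := by
    rw [hc_real, show (2 : ℝ≥0∞)⁻¹ = ENNReal.ofReal (1 / 2) by
      rw [ENNReal.ofReal_div_of_pos (by norm_num)]; norm_num]
    exact (ENNReal.ofReal_lt_ofReal_iff (by norm_num)).2 (by norm_num)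
  have hc1 : c < 1 := by
    rw [hc_real, ← ENNReal.ofReal_one]
    exact (ENNReal.ofReal_lt_ofReal_iff (by norm_num)).2 (by norm_num)
  set r := Fernique.logRatio c with hr
  have hr0 : 0 < r := Fernique.logRatio_pos hc2 hc1
  set B : ℝ≥0∞ := .ofReal (Real.exp (Fernique.logRatio c))
        + ∑' n : ℕ, .ofReal (Real.exp (-2⁻¹ * Real.log (c / (1 - c)).toReal * 2 ^ n)) with hB
  have hB_top : B ≠ ∞ := by
    refine ENNReal.add_ne_top.2 ⟨ENNReal.ofReal_ne_top, ?_⟩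
    refine (Summable.tsum_ofReal_lt_top <|
      Real.summable_exp_nat_mul_of_ge ?_ fun i => mod_cast (Nat.lt_pow_self (by simp)).le).ne
    refine mul_neg_of_neg_of_pos (by simp) (Real.log_pos ?_)
    rw [hc_real, ← ENNReal.ofReal_one, ← ENNReal.ofReal_sub _ (by norm_num),
      ENNReal.toReal_div, ENNReal.toReal_ofReal (by norm_num), ENNReal.toReal_ofReal (by norm_num)]
    norm_num
  refine ⟨ENNReal.ofReal r⁻¹ * B, ENNReal.mul_ne_top ENNReal.ofReal_ne_top hB_top, ?_⟩
  intro ι _ x a ha hx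
  let A : (ι → ℂ) →L[ℝ] X := LinearMap.toContinuousLinearMap
    { toFun := fun g => ∑ i, g i • x i
      map_add' := fun g h => by simp [add_smul, Finset.sum_add_distrib]
      map_smul' := fun c g => by simp [Finset.smul_sum, mul_smul] }
  have hA : ∀ g, A g = ∑ i, g i • x i := fun _ => rfl
  let ν : Measure X := (gaussianPi ι).map A
  have hν : IsProbabilityMeasure ν := Measure.isProbabilityMeasure_map (by fun_prop)
  have h0 : ∀ L : StrongDual ℝ X, ∫ x, L x ∂ν = 0 := by
    intro L
    rw [integral_map (by fun_prop) (by fun_prop)]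
    exact integral_dual_gaussianPi (L.comp A)
  -- A centred Gaussian law makes `ν × ν` rotation invariant, which is the hypothesis of Fernique's
  -- theorem.
  have hrot := IsGaussian.map_rotation_eq_self_of_forall_strongDual_eq_zero (μ := ν) h0
    (-(Real.pi / 4))
  have hcν : c ≤ ν {x | ‖x‖ ≤ a} := by
    rw [Measure.map_apply (by fun_prop) (measurableSet_le (by fun_prop) (by fun_prop))]
    exact hx
  have hF := lintegral_exp_mul_sq_norm_le_of_map_rotation_eq_self hrot hcν hc2
  have h1 : ∫⁻ g, ‖∑ i, g i • x i‖ₑ ^ 2 ∂gaussianPi ι = ∫⁻ y, ‖y‖ₑ ^ 2 ∂ν := by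
    rw [lintegral_map (by fun_prop) (by fun_prop)]
    simp_rw [hA]
  rw [h1]
  calc ∫⁻ y, ‖y‖ₑ ^ 2 ∂ν
      ≤ ∫⁻ y, ENNReal.ofReal (r⁻¹ * a ^ 2) *
          ENNReal.ofReal (Real.exp (r * a⁻¹ ^ 2 * ‖y‖ ^ 2)) ∂ν := by
        refine lintegral_mono fun y => ?_
        rw [← ofReal_norm, ← ENNReal.ofReal_pow (norm_nonneg _),
          ← ENNReal.ofReal_mul (by positivity)]
        refine ENNReal.ofReal_le_ofReal ?_
        -- The exponential moment dominates the second moment through `t ≤ exp t`.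
        have := Real.add_one_le_exp (r * a⁻¹ ^ 2 * ‖y‖ ^ 2)
        calc ‖y‖ ^ 2 = r⁻¹ * a ^ 2 * (r * a⁻¹ ^ 2 * ‖y‖ ^ 2) := by field_simp
          _ ≤ _ := by gcongr; linarith
    _ = ENNReal.ofReal (r⁻¹ * a ^ 2) *
          ∫⁻ y, ENNReal.ofReal (Real.exp (r * a⁻¹ ^ 2 * ‖y‖ ^ 2)) ∂ν :=
        lintegral_const_mul _ (by fun_prop)
    _ ≤ ENNReal.ofReal (r⁻¹ * a ^ 2) * B := by gcongr
    _ = ENNReal.ofReal r⁻¹ * B * ENNReal.ofReal (a ^ 2) := by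
        rw [ENNReal.ofReal_mul (by positivity)]; ring

end GaussianPi

/-! ### Comparison of Gaussian sums under contractive matrices. -/

section GaussianPi

variable {ι κ : Type*} [Fintype ι] [Fintype κ]
variable {X : Type*} [NormedAddCommGroup X] [NormedSpace ℂ X]

theorem integrable_norm_sum_smul_gaussianPi (x : ι → X) :
    Integrable (fun g : ι → ℂ => ‖∑ i, g i • x i‖) (gaussianPi ι) :=
  ((memLp_sum_smul_gaussianPi x 1 (by simp)).integrable le_rfl).norm

theorem integral_norm_sum_smul_gaussianPi [DecidableEq ι] {w : Matrix κ ι ℂ}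
    (hw : w.conjTranspose * w = 1) (x : ι → X) :
    ∫ g, ‖∑ k, g k • ∑ i, w k i • x i‖ ∂gaussianPi κ = ∫ g, ‖∑ i, g i • x i‖ ∂gaussianPi ι := by
  have hm : Measurable (fun (g : κ → ℂ) i => ∑ k, w k i * g k) := by fun_prop
  rw [← map_gaussianPi hw, integral_map hm.aemeasurable
    (Continuous.aestronglyMeasurable (by fun_prop))]
  congr 1
  ext g
  simp_rw [Finset.smul_sum, Finset.sum_smul]
  rw [Finset.sum_comm]
  simp_rw [smul_smul, mul_comm]

open scoped MatrixOrder Matrix.Norms.L2Operator ComplexOrder in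
/-- A contractive matrix has a defect matrix. -/
theorem exists_defect_matrix [DecidableEq ι] {a : Matrix κ ι ℂ}
    (ha : ∀ c : ι → ℂ, ∑ k, ‖a.mulVec c k‖ ^ 2 ≤ ∑ i, ‖c i‖ ^ 2) :
    ∃ b : Matrix ι ι ℂ, 1 - a.conjTranspose * a = b.conjTranspose * b := by
  refine CStarAlgebra.nonneg_iff_eq_star_mul_self.mp ?_
  rw [Matrix.nonneg_iff_posSemidef]
  refine Matrix.PosSemidef.of_dotProduct_mulVec_nonneg ?_ fun c => ?_
  · exact Matrix.isHermitian_one.sub (Matrix.isHermitian_conjTranspose_mul_self a)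
  · rw [Matrix.sub_mulVec, dotProduct_sub, Matrix.one_mulVec, ← Matrix.mulVec_mulVec,
      Matrix.dotProduct_mulVec, ← Matrix.star_mulVec, ← ofReal_sum_norm_sq, ← ofReal_sum_norm_sq,
      ← Complex.ofReal_sub]
    exact_mod_cast sub_nonneg.2 (ha c)

/-- Comparison of Gaussian sums: applying a contractive matrix to the vectors of a Gaussian sum
does not increase the expected norm. -/
theorem integral_norm_sum_smul_gaussianPi_le [DecidableEq ι] {a : Matrix κ ι ℂ}
    (ha : ∀ c : ι → ℂ, ∑ k, ‖a.mulVec c k‖ ^ 2 ≤ ∑ i, ‖c i‖ ^ 2) (x : ι → X) :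
    ∫ g, ‖∑ k, g k • ∑ i, a k i • x i‖ ∂gaussianPi κ ≤ ∫ g, ‖∑ i, g i • x i‖ ∂gaussianPi ι := by
  classical
  obtain ⟨b, hb⟩ := exists_defect_matrix ha
  -- Stacking `a` on its defect `b` gives an isometry, so the Gaussian sum of `x` has the same
  -- expected norm as a sum of two independent pieces with vectors `u` and `v`.
  have hw : (Matrix.fromRows a b).conjTranspose * Matrix.fromRows a b = 1 := by
    rw [Matrix.conjTranspose_fromRows_eq_fromCols_conjTranspose, Matrix.fromCols_mul_fromRows, ← hb]
    simp
  -- This isometry flips the sign of the second piece.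
  have hs : (Matrix.diagonal (Sum.elim (fun _ : κ => (1 : ℂ)) fun _ : ι => -1)).conjTranspose *
      Matrix.diagonal (Sum.elim (fun _ : κ => (1 : ℂ)) fun _ : ι => -1) = 1 := by
    rw [Matrix.diagonal_conjTranspose, Matrix.diagonal_mul_diagonal, ← Matrix.diagonal_one]
    congr 1
    ext (k | i) <;> simp
  have hp : (Matrix.fromRows (1 : Matrix κ κ ℂ) (0 : Matrix ι κ ℂ)).conjTranspose *
      Matrix.fromRows (1 : Matrix κ κ ℂ) (0 : Matrix ι κ ℂ) = 1 := by
    rw [Matrix.conjTranspose_fromRows_eq_fromCols_conjTranspose, Matrix.fromCols_mul_fromRows]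
    simp
  let u : κ → X := fun k => ∑ i, a k i • x i
  let v : ι → X := fun j => ∑ i, b j i • x i
  have e1 : ∫ g, ‖∑ k, g (.inl k) • u k + ∑ j, g (.inr j) • v j‖ ∂gaussianPi (κ ⊕ ι) =
      ∫ g, ‖∑ i, g i • x i‖ ∂gaussianPi ι := by
    rw [← integral_norm_sum_smul_gaussianPi hw x]
    simp [Fintype.sum_sum_type, u, v]
  have e2 : ∫ g, ‖∑ k, g (.inl k) • u k - ∑ j, g (.inr j) • v j‖ ∂gaussianPi (κ ⊕ ι) =
      ∫ g, ‖∑ i, g i • x i‖ ∂gaussianPi ι := by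
    rw [← e1]
    have := integral_norm_sum_smul_gaussianPi hs (Sum.elim u v)
    simpa [Fintype.sum_sum_type, Matrix.diagonal_apply, ite_smul, sub_eq_add_neg] using this
  have e3 : ∫ g, ‖∑ k, g (.inl k) • u k‖ ∂gaussianPi (κ ⊕ ι) =
      ∫ g, ‖∑ k, g k • u k‖ ∂gaussianPi κ := by
    rw [← integral_norm_sum_smul_gaussianPi hp u]
    simp [Fintype.sum_sum_type, Matrix.one_apply, ite_smul]
  have i1 := integrable_norm_sum_smul_gaussianPi (Sum.elim u v)
  have i2 := integrable_norm_sum_smul_gaussianPi (Sum.elim u (-v))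
  have i3 := integrable_norm_sum_smul_gaussianPi (Sum.elim u (0 : ι → X))
  simp only [Fintype.sum_sum_type, Sum.elim_inl, Sum.elim_inr, Pi.neg_apply, smul_neg,
    Finset.sum_neg_distrib, ← sub_eq_add_neg, Pi.zero_apply, smul_zero, Finset.sum_const_zero,
    add_zero] at i1 i2 i3
  -- Averaging over the sign: twice the `u`-piece is `(u + v) + (u - v)`, and both terms have the
  -- expected norm of the original sum.
  have e4 : ∫ g, 2 * ‖∑ k, g (.inl k) • u k‖ ∂gaussianPi (κ ⊕ ι) ≤
      ∫ g, (‖∑ k, g (.inl k) • u k + ∑ j, g (.inr j) • v j‖ +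
        ‖∑ k, g (.inl k) • u k - ∑ j, g (.inr j) • v j‖) ∂gaussianPi (κ ⊕ ι) := by
    refine integral_mono (i3.const_mul 2) (i1.add i2) fun g => ?_
    have h := norm_add_le (∑ k, g (.inl k) • u k + ∑ j, g (.inr j) • v j)
      (∑ k, g (.inl k) • u k - ∑ j, g (.inr j) • v j)
    rw [add_add_sub_cancel, ← two_smul ℝ, norm_smul] at h
    simpa using h
  rw [integral_const_mul, integral_add i1 i2, e1, e2, e3] at e4
  change ∫ g, ‖∑ k, g k • u k‖ ∂gaussianPi κ ≤ _
  linarith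

end GaussianPi

/-! ### Cotype 2 and square function estimates. -/

section Cotype

variable {X : Type*} [NormedAddCommGroup X] [NormedSpace ℂ X]

/-- Cotype 2 is applied to the transformed vectors, whose Gaussian average is at most that of `x` by
contractivity of `a`. -/
theorem HasCotypeTwo.exists_sqrt_sum_le (hX : HasCotypeTwo X) :
    ∃ C : ℝ, 0 ≤ C ∧ ∀ (ι κ : Type) [Fintype ι] [Fintype κ] (a : Matrix κ ι ℂ) (x : ι → X),
      (∀ c : ι → ℂ, ∑ k, ‖a.mulVec c k‖ ^ 2 ≤ ∑ i, ‖c i‖ ^ 2) →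
      ∑ k, ‖∑ i, a k i • x i‖ ^ 2 ≤ (C * ∫ g, ‖∑ i, g i • x i‖ ∂gaussianPi ι) ^ 2 := by
  classical
  obtain ⟨C, hC⟩ := hX
  refine ⟨max C 0, le_max_right _ _, fun ι κ _ _ a x ha => ?_⟩
  let e := Fintype.equivFin κ
  have h1 := hC _ fun n => ∑ i, a (e.symm n) i • x i
  rw [e.symm.sum_comp (fun k => ‖∑ i, a k i • x i‖ ^ 2)] at h1
  have h2 := integral_norm_sum_smul_gaussianPi_le (a := a.submatrix e.symm id) (by
    intro c
    refine le_trans (le_of_eq ?_) (ha c)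
    exact e.symm.sum_comp fun k => ‖a.mulVec c k‖ ^ 2) x
  simp only [Matrix.submatrix_apply, id] at h2
  have h3 : 0 ≤ ∫ g : Fin (Fintype.card κ) → ℂ, ‖∑ n, g n • ∑ i, a (e.symm n) i • x i‖
      ∂gaussianPi (Fin (Fintype.card κ)) := integral_nonneg fun _ => norm_nonneg _
  have h4 : Real.sqrt (∑ k, ‖∑ i, a k i • x i‖ ^ 2) ≤
      max C 0 * ∫ g, ‖∑ i, g i • x i‖ ∂gaussianPi ι :=
    h1.trans (mul_le_mul (le_max_left _ _) h2 h3 (le_max_right _ _))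
  rw [Real.sqrt_le_left (h4.trans' (Real.sqrt_nonneg _))] at h4
  exact h4

variable {Ω : Type*} [MeasurableSpace Ω] {ν : Measure Ω}

theorem eLpNorm_two_le_iff {E : Type*} [NormedAddCommGroup E] {f : Ω → E} (hf : MemLp f 2 ν)
    {r : ℝ} (hr : 0 ≤ r) :
    eLpNorm f 2 ν ≤ ENNReal.ofReal r ↔ ∫ ω, ‖f ω‖ ^ 2 ∂ν ≤ r ^ 2 := by
  rw [hf.eLpNorm_eq_integral_rpow_norm (by simp) (by simp), ENNReal.ofReal_le_ofReal_iff hr]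
  have h0 : 0 ≤ ∫ ω, ‖f ω‖ ^ 2 ∂ν := integral_nonneg fun _ => by positivity
  simp only [ENNReal.toReal_ofNat, Real.rpow_ofNat]
  rw [show (2 : ℝ)⁻¹ = 1 / 2 by norm_num, ← Real.sqrt_eq_rpow, Real.sqrt_le_left hr]

variable [IsFiniteMeasure ν]

theorem integral_simpleFunc_comp {E : Type*} [NormedAddCommGroup E] (G : SimpleFunc Ω E)
    (φ : E → ℝ) (hφ : φ 0 = 0) :
    ∫ ω, φ (G ω) ∂ν = ∑ v : G.range, ν.real (G ⁻¹' {v.1}) * φ v := by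
  have h : ∀ ω, φ (G ω) = (G.map φ) ω := fun _ => rfl
  simp_rw [h]
  rw [← SimpleFunc.integral_eq_integral _ ((G.map φ).integrable_of_isFiniteMeasure),
    SimpleFunc.map_integral _ _ G.integrable_of_isFiniteMeasure hφ, ← Finset.sum_coe_sort]
  rfl

/-- The square function estimate in a space of cotype 2, for contractive families in `L²`. -/
theorem HasCotypeTwo.exists_eLpNorm_le (hX : HasCotypeTwo X) :
    ∃ C : ℝ, 0 ≤ C ∧ ∀ (ι : Type) [Fintype ι] (x : ι → X) {Ω : Type} [MeasurableSpace Ω]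
      (ν : Measure Ω) [IsFiniteMeasure ν] (F : Ω → EuclideanSpace ℂ ι), MemLp F 2 ν →
      (∀ c : EuclideanSpace ℂ ι, eLpNorm (fun ω => inner ℂ c (F ω)) 2 ν ≤ ‖c‖ₑ) →
      eLpNorm (fun ω => ∑ i, F ω i • x i) 2 ν ≤
        ENNReal.ofReal (C * ∫ g, ‖∑ i, g i • x i‖ ∂gaussianPi ι) := by
  obtain ⟨C, hC0, hC⟩ := hX.exists_sqrt_sum_le
  refine ⟨C, hC0, fun ι _ x Ω _ ν _ F hF hc => ?_⟩
  set M := C * ∫ g, ‖∑ i, g i • x i‖ ∂gaussianPi ι with hM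
  have hM0 : 0 ≤ M := mul_nonneg hC0 (integral_nonneg fun _ => norm_nonneg _)
  -- For a step function the weak `L²` bound says exactly that the matrix with rows `l⁻¹ √ν(G = v) •
  -- v` is contractive. The factor `l` leaves room for the error made in approximating `F`.
  have simple : ∀ (G : SimpleFunc Ω (EuclideanSpace ℂ ι)) (l : ℝ), 0 < l →
      (∀ c : EuclideanSpace ℂ ι, ∫ ω, ‖inner ℂ c (G ω)‖ ^ 2 ∂ν ≤ (l * ‖c‖) ^ 2) →
      ∫ ω, ‖∑ i, G ω i • x i‖ ^ 2 ∂ν ≤ (l * M) ^ 2 := by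
    intro G l hl hG
    -- discretize along the level sets of `G`
    let s : G.range → ℝ := fun v => √(ν.real (G ⁻¹' {v.1}))
    have hs : ∀ v, ν.real (G ⁻¹' {v.1}) = s v ^ 2 := fun v =>
      (Real.sq_sqrt measureReal_nonneg).symm
    have h := hC ι G.range (fun v i => ((l⁻¹ * s v : ℝ) : ℂ) * v.1 i) x ?_
    · rw [integral_simpleFunc_comp G (fun v => ‖∑ i, v i • x i‖ ^ 2) (by simp), mul_pow,
        ← inv_mul_le_iff₀ (by positivity), Finset.mul_sum]
      refine le_trans (le_of_eq (Finset.sum_congr rfl fun v _ => ?_)) h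
      simp_rw [mul_smul, ← Finset.smul_sum]
      rw [norm_smul, hs, Complex.norm_real, Real.norm_eq_abs, mul_pow, sq_abs]
      ring
    · intro c
      have h1 := hG (WithLp.toLp 2 (star c))
      rw [integral_simpleFunc_comp G (fun v => ‖inner ℂ (WithLp.toLp 2 (star c)) v‖ ^ 2) (by simp),
        mul_pow, ← inv_mul_le_iff₀ (by positivity), Finset.mul_sum,
        EuclideanSpace.norm_sq_eq] at h1
      refine le_trans (le_of_eq (Finset.sum_congr rfl fun v _ => ?_)) (h1.trans_eq (by simp))
      have : (Matrix.mulVec (fun v i => ((l⁻¹ * s v : ℝ) : ℂ) * v.1 i :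
          Matrix G.range ι ℂ) c v) = ((l⁻¹ * s v : ℝ) : ℂ) *
            inner ℂ (WithLp.toLp 2 (star c)) v.1 := by
        simp [Matrix.mulVec, dotProduct, PiLp.inner_apply, Finset.mul_sum, mul_assoc]
      rw [this, norm_mul, hs, Complex.norm_real, Real.norm_eq_abs, mul_pow, sq_abs]
      ring
  let T : EuclideanSpace ℂ ι →L[ℂ] X := LinearMap.toContinuousLinearMap
    { toFun := fun v => ∑ i, v i • x i
      map_add' := fun v w => by simp [add_smul, Finset.sum_add_distrib]
      map_smul' := fun c v => by simp [Finset.smul_sum, mul_smul] }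
  have hT : ∀ v, T v = ∑ i, v i • x i := fun _ => rfl
  -- Approximating `F` within `ε` costs `1 + ε` in the weak bound and `‖T‖ * ε` in the conclusion.
  -- The norm `‖T‖` may depend on `ι` and `x`, but disappears as `ε → 0`.
  have main : ∀ ε : ℝ, 0 < ε →
      eLpNorm (fun ω => T (F ω)) 2 ν ≤ ENNReal.ofReal (‖T‖ * ε + (1 + ε) * M) := by
    intro ε hε
    obtain ⟨G, hGε, hG⟩ := hF.exists_simpleFunc_eLpNorm_sub_lt (by simp)
      (ε := ENNReal.ofReal ε) (by simpa using hε)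
    have hFG := hF.sub hG
    have hTG : MemLp (fun ω => T (G ω)) 2 ν := T.comp_memLp' hG
    have hinner : ∀ (c : EuclideanSpace ℂ ι) {H : Ω → EuclideanSpace ℂ ι}, MemLp H 2 ν →
        eLpNorm (fun ω => inner ℂ c (H ω)) 2 ν ≤ ‖c‖ₑ * eLpNorm H 2 ν := by
      intro c H hH
      have := eLpNorm_le_mul_eLpNorm_of_ae_le_mul (f := fun ω => inner ℂ c (H ω)) (g := H)
        (c := ‖c‖) (μ := ν) (ae_of_all _ fun ω => norm_inner_le_norm c (H ω)) 2
      simpa using this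
    have hGl := simple G (1 + ε) (by positivity) fun c => by
      have hm : MemLp (fun ω => inner ℂ c (G ω)) 2 ν := hG.const_inner c
      rw [← eLpNorm_two_le_iff hm (by positivity)]
      calc eLpNorm (fun ω => inner ℂ c (G ω)) 2 ν
          = eLpNorm ((fun ω => inner ℂ c (F ω)) - fun ω => inner ℂ c ((F - G) ω)) 2 ν := by
            congr 1; ext ω; simp
        _ ≤ eLpNorm (fun ω => inner ℂ c (F ω)) 2 ν +
              eLpNorm (fun ω => inner ℂ c ((F - G) ω)) 2 ν :=
            eLpNorm_sub_le (hF.const_inner c).1 (hFG.const_inner c).1 (by simp)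
        _ ≤ ‖c‖ₑ + ‖c‖ₑ * ENNReal.ofReal ε :=
            add_le_add (hc c) ((hinner c hFG).trans (by gcongr))
        _ = ENNReal.ofReal ((1 + ε) * ‖c‖) := by
            rw [← ofReal_norm, ← ENNReal.ofReal_mul (by positivity),
              ← ENNReal.ofReal_add (by positivity) (by positivity)]
            congr 1; ring
    have hGl2 : eLpNorm (fun ω => T (G ω)) 2 ν ≤ ENNReal.ofReal ((1 + ε) * M) :=
      (eLpNorm_two_le_iff hTG (by positivity)).2 hGl
    calc eLpNorm (fun ω => T (F ω)) 2 ν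
        = eLpNorm ((fun ω => T ((F - G) ω)) + fun ω => T (G ω)) 2 ν := by
          congr 1; ext ω; simp
      _ ≤ eLpNorm (fun ω => T ((F - G) ω)) 2 ν + eLpNorm (fun ω => T (G ω)) 2 ν :=
          eLpNorm_add_le (T.comp_memLp' hFG).1 hTG.1 (by simp)
      _ ≤ ENNReal.ofReal (‖T‖ * ε) + ENNReal.ofReal ((1 + ε) * M) := by
          refine add_le_add ?_ hGl2
          have := eLpNorm_le_mul_eLpNorm_of_ae_le_mul (f := fun ω => T ((F - G) ω)) (g := F - ⇑G)
            (c := ‖T‖) (μ := ν) (ae_of_all _ fun ω => T.le_opNorm _) 2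
          rw [ENNReal.ofReal_mul (norm_nonneg _)]
          exact this.trans (by gcongr)
      _ = _ := (ENNReal.ofReal_add (by positivity) (by positivity)).symm
  refine ge_of_tendsto (x := 𝓝[>] (0 : ℝ)) ?_ (eventually_nhdsWithin_of_forall main)
  have : Tendsto (fun ε : ℝ => ‖T‖ * ε + (1 + ε) * M) (𝓝[>] 0) (𝓝 M) := by
    refine Tendsto.mono_left ?_ nhdsWithin_le_nhds
    have : Continuous (fun ε : ℝ => ‖T‖ * ε + (1 + ε) * M) := by fun_prop
    simpa using this.tendsto 0
  exact ENNReal.tendsto_ofReal this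

end Cotype

/-! ### Almost surely convergent Gaussian series. -/

section Series

theorem integral_stdComplexGaussian : ∫ z, z ∂stdComplexGaussian = 0 := by
  have h : ∀ L : StrongDual ℝ ℂ, ∫ z, L z ∂stdComplexGaussian = 0 := by
    intro L
    have h1 := integral_dual_gaussianPi
      (L.comp (ContinuousLinearMap.proj (R := ℝ) (φ := fun _ : Unit => ℂ) ()))
    have h2 := (measurePreserving_eval (fun _ : Unit => stdComplexGaussian) ()).map_eq
    rw [← h2, integral_map (measurable_pi_apply ()).aemeasurable (by fun_prop)]
    exact h1
  have hi : Integrable (fun z : ℂ => z) stdComplexGaussian := IsGaussian.integrable_id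
  rw [← integral_re_add_im hi]
  have h1 := h Complex.reCLM
  have h2 := h Complex.imCLM
  simp only [Complex.reCLM_apply, Complex.imCLM_apply] at h1 h2
  simp [h1, h2]

theorem integral_norm_sq_stdComplexGaussian : ∫ z, ‖z‖ ^ 2 ∂stdComplexGaussian = 1 := by
  have hv : ∫ x : ℝ, x ^ 2 ∂gaussianReal 0 (1 / 2) = 1 / 2 := by
    have := variance_fun_id_gaussianReal (μ := 0) (v := 1 / 2)
    rw [variance_of_integral_eq_zero (by fun_prop) (by simp)] at this
    simpa using this
  have hi : Integrable (fun x : ℝ => x ^ 2) (gaussianReal 0 (1 / 2)) :=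
    (memLp_id_gaussianReal (μ := 0) (v := 1 / 2) 2).integrable_sq
  have h1 : (fun z : ℂ => ‖z‖ ^ 2) = fun z => z.re ^ 2 + z.im ^ 2 := by
    ext z; rw [Complex.sq_norm, Complex.normSq_apply]; ring
  rw [h1, stdComplexGaussian, integral_map (by fun_prop) (by fun_prop)]
  simp only [Complex.measurableEquivRealProd_symm_apply]
  rw [integral_add (hi.comp_fst _) (hi.comp_snd _), integral_fun_fst (fun x : ℝ => x ^ 2),
    integral_fun_snd (fun x : ℝ => x ^ 2), hv]
  norm_num

variable {Ω : Type*} [MeasurableSpace Ω] {P : Measure Ω}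
  {g : ℕ → Ω → ℂ}

theorem eLpNorm_two_le_ofReal {E : Type*} [NormedAddCommGroup E] {ν : Measure Ω} {f : Ω → E}
    {r : ℝ} (hr : 0 ≤ r) (h : ∫⁻ ω, ‖f ω‖ₑ ^ 2 ∂ν ≤ ENNReal.ofReal (r ^ 2)) :
    eLpNorm f 2 ν ≤ ENNReal.ofReal r := by
  rw [eLpNorm_eq_lintegral_rpow_enorm_toReal (by simp) (by simp)]
  simp only [ENNReal.toReal_ofNat, ENNReal.rpow_ofNat]
  refine (ENNReal.rpow_le_rpow h (by norm_num)).trans ?_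
  rw [ENNReal.ofReal_rpow_of_nonneg (by positivity) (by norm_num), ← Real.sqrt_eq_rpow,
    Real.sqrt_sq hr]

namespace IsStdComplexGaussianSeq

theorem map_finset [IsProbabilityMeasure P] (hg : IsStdComplexGaussianSeq P g) (s : Finset ℕ) :
    P.map (fun ω (i : s) => g i ω) = gaussianPi s := by
  have h1 : iIndepFun (fun i : s => g i) P := hg.2.precomp Subtype.val_injective
  rw [(iIndepFun_iff_map_fun_eq_pi_map fun i : s => (hg.1 i).aemeasurable).1 h1]
  simp_rw [(hg.1 _).map_eq]

theorem memLp (hg : IsStdComplexGaussianSeq P g) (n : ℕ) : MemLp (g n) 2 P := by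
  have h : MemLp (id : ℂ → ℂ) 2 stdComplexGaussian := IsGaussian.memLp_id _ 2 (by simp)
  rw [← (hg.1 n).map_eq] at h
  exact (memLp_map_measure_iff h.1 (hg.1 n).aemeasurable).1 (by simpa using h)

theorem integral_eq_zero (hg : IsStdComplexGaussianSeq P g) (n : ℕ) : ∫ ω, g n ω ∂P = 0 := by
  rw [(hg.1 n).integral_eq, integral_stdComplexGaussian]

theorem orthonormal (hg : IsStdComplexGaussianSeq P g) :
    Orthonormal ℂ fun n => (hg.memLp n).toLp (g n) := by
  classical
  rw [orthonormal_iff_ite]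
  intro m n
  have h1 : inner ℂ ((hg.memLp m).toLp (g m)) ((hg.memLp n).toLp (g n)) =
      ∫ ω, (starRingEnd ℂ) (g m ω) * g n ω ∂P := by
    rw [L2.inner_def]
    refine integral_congr_ae ?_
    filter_upwards [(hg.memLp m).coeFn_toLp, (hg.memLp n).coeFn_toLp] with ω e1 e2
    rw [e1, e2]
    simp [mul_comm]
  rw [h1]
  split_ifs with h
  · subst h
    have h2 : ∀ ω, (starRingEnd ℂ) (g m ω) * g m ω = ((‖g m ω‖ ^ 2 : ℝ) : ℂ) := by
      intro ω; rw [Complex.conj_mul']; push_cast; rfl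
    simp_rw [h2]
    have h3 : ∫ ω, ‖g m ω‖ ^ 2 ∂P = 1 := by
      rw [← integral_norm_sq_stdComplexGaussian]
      exact (hg.1 m).integral_comp (f := fun z : ℂ => ‖z‖ ^ 2) (by fun_prop)
    rw [integral_complex_ofReal, h3, Complex.ofReal_one]
  · have hind : IndepFun (fun ω => (starRingEnd ℂ) (g m ω)) (g n) P :=
      (hg.2.indepFun h).comp (φ := fun z : ℂ => (starRingEnd ℂ) z) (ψ := id)
        Complex.continuous_conj.measurable measurable_id
    rw [hind.integral_fun_mul_eq_mul_integral
      (Complex.continuous_conj.comp_aestronglyMeasurable (hg.memLp m).1) (hg.memLp n).1,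
      hg.integral_eq_zero n, mul_zero]

variable {X : Type*} [NormedAddCommGroup X] [NormedSpace ℂ X] {x : ℕ → X}

theorem memLp_sum (hg : IsStdComplexGaussianSeq P g) (s : Finset ℕ) :
    MemLp (fun ω => ∑ n ∈ s, g n ω • x n) 2 P :=
  memLp_finsetSum _ fun n _ =>
    ((ContinuousLinearMap.id ℂ ℂ).smulRight (x n)).comp_memLp' (hg.memLp n)

variable [IsProbabilityMeasure P] [CompleteSpace X] [MeasurableSpace X] [BorelSpace X]
  [SecondCountableTopology X] {ξ : Ω → X}

/-- The tails of an almost surely convergent Gaussian series are small in the mean. -/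
theorem exists_tail_le (hg : IsStdComplexGaussianSeq P g)
    (hlim : ∀ᵐ ω ∂P, Tendsto (fun N : ℕ => ∑ n ∈ Finset.range N, g n ω • x n) atTop (𝓝 (ξ ω)))
    {ε : ℝ} (hε : 0 < ε) :
    ∃ N₀ : ℕ, ∀ M N, N₀ ≤ M → M ≤ N →
      ∫ h, ‖∑ i, h i • x i‖ ∂gaussianPi (Finset.Ico M N) ≤ ε ∧
      eLpNorm (fun ω => ∑ n ∈ Finset.Ico M N, g n ω • x n) 2 P ≤ ENNReal.ofReal ε := by
  obtain ⟨K, hK, hF⟩ := exists_lintegral_enorm_sq_gaussianPi_le (X := X)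
  -- Chosen so that `K * a ^ 2 ≤ ε ^ 2`; the `+ 1` keeps the denominator positive.
  set a : ℝ := ε / √(K.toReal + 1) with ha
  have ha0 : 0 < a := by positivity
  have hKa : K * ENNReal.ofReal (a ^ 2) ≤ ENNReal.ofReal (ε ^ 2) := by
    rw [← ENNReal.ofReal_toReal hK, ← ENNReal.ofReal_mul ENNReal.toReal_nonneg]
    refine ENNReal.ofReal_le_ofReal ?_
    rw [ha, div_pow, Real.sq_sqrt (by positivity), mul_div_assoc', div_le_iff₀ (by positivity)]
    nlinarith [sq_nonneg ε, ENNReal.toReal_nonneg (a := K)]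
  -- Convergence in probability: two late partial sums are each within `a / 2` of `ξ` off events of
  -- probability at most `1/8`, so their difference is at most `a` with probability at least `3/4`,
  -- the level required by the Fernique bound.
  have hmeas := tendstoInMeasure_of_tendsto_ae (fun N => (hg.memLp_sum (Finset.range N)).1) hlim
    (ENNReal.ofReal (a / 2)) (by simpa using ha0)
  obtain ⟨N₀, hN₀⟩ := eventually_atTop.1
    (hmeas.eventually_le_const (u := ENNReal.ofReal (1 / 8)) (by simp))
  refine ⟨N₀, fun M N hM hMN => ?_⟩
  have hsub : ∀ ω, ∑ n ∈ Finset.Ico M N, g n ω • x n =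
      ∑ n ∈ Finset.range N, g n ω • x n - ∑ n ∈ Finset.range M, g n ω • x n := fun ω =>
    Finset.sum_Ico_eq_sub _ hMN
  have hgood : 3 / 4 ≤ P {ω | ‖∑ n ∈ Finset.Ico M N, g n ω • x n‖ ≤ a} := by
    set A := {ω | ENNReal.ofReal (a / 2) ≤ edist (∑ n ∈ Finset.range N, g n ω • x n) (ξ ω)}
    set B := {ω | ENNReal.ofReal (a / 2) ≤ edist (∑ n ∈ Finset.range M, g n ω • x n) (ξ ω)}
    have hA : P A ≤ ENNReal.ofReal (1 / 8) := hN₀ N (hM.trans hMN)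
    have hB : P B ≤ ENNReal.ofReal (1 / 8) := hN₀ M hM
    have hcover : Set.univ ⊆ {ω | ‖∑ n ∈ Finset.Ico M N, g n ω • x n‖ ≤ a} ∪ (A ∪ B) := by
      intro ω _
      by_contra hω
      simp only [Set.mem_union, Set.mem_ofPred_eq, not_or, not_le, A, B, edist_dist] at hω
      obtain ⟨h1, h2, h3⟩ := hω
      rw [ENNReal.ofReal_lt_ofReal_iff (by positivity)] at h2 h3
      rw [hsub, ← dist_eq_norm] at h1
      have := dist_triangle_right (∑ n ∈ Finset.range N, g n ω • x n)
        (∑ n ∈ Finset.range M, g n ω • x n) (ξ ω)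
      linarith
    have h1 : 1 ≤ P {ω | ‖∑ n ∈ Finset.Ico M N, g n ω • x n‖ ≤ a} +
        (ENNReal.ofReal (1 / 8) + ENNReal.ofReal (1 / 8)) := by
      rw [← measure_univ (μ := P)]
      refine (measure_mono hcover).trans ((measure_union_le _ _).trans ?_)
      gcongr
      exact (measure_union_le _ _).trans (add_le_add hA hB)
    rw [← ENNReal.ofReal_add (by norm_num) (by norm_num)] at h1
    have h2 := tsub_le_iff_right.2 h1
    refine le_trans (le_of_eq ?_) h2
    rw [← ENNReal.ofReal_one, ← ENNReal.ofReal_sub _ (by norm_num),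
      show (1 : ℝ) - (1 / 8 + 1 / 8) = 3 / 4 by norm_num, ENNReal.ofReal_div_of_pos (by norm_num)]
    norm_num
  have hmg : AEMeasurable (fun ω (i : Finset.Ico M N) => g i ω) P :=
    aemeasurable_pi_lambda _ fun i => (hg.1 i).aemeasurable
  have hcoe : ∀ ω, ∑ n ∈ Finset.Ico M N, g n ω • x n =
      ∑ i : Finset.Ico M N, g i ω • x i := fun ω =>
    (Finset.sum_coe_sort (Finset.Ico M N) fun n => g n ω • x n).symm
  have hc : Continuous fun h : Finset.Ico M N → ℂ => ∑ i, h i • x i := by fun_prop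
  have h1 : 3 / 4 ≤ gaussianPi (Finset.Ico M N) {h | ‖∑ i, h i • x i‖ ≤ a} := by
    rw [← hg.map_finset, Measure.map_apply_of_aemeasurable hmg
      (measurableSet_le hc.norm.measurable measurable_const)]
    simp only [hcoe] at hgood
    exact hgood
  have h2 := (hF (Finset.Ico M N) (fun i => x i) a ha0 h1).trans hKa
  have h3 := eLpNorm_two_le_ofReal hε.le h2
  constructor
  · have h4 := (eLpNorm_le_eLpNorm_of_exponent_le (p := 1) (q := 2) (by norm_num)
      hc.aestronglyMeasurable).trans h3
    rw [eLpNorm_one_eq_lintegral_enorm] at h4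
    rw [integral_norm_eq_lintegral_enorm hc.aestronglyMeasurable]
    exact ENNReal.toReal_le_of_le_ofReal hε.le h4
  · refine eLpNorm_two_le_ofReal hε.le ?_
    simp_rw [hcoe]
    rw [← hg.map_finset, lintegral_map' (hc.enorm.measurable.pow_const 2).aemeasurable hmg] at h2
    exact h2

/-- Fatou's lemma, letting the upper end of the block tend to infinity with the lower end fixed. -/
theorem exists_eLpNorm_sub_le (hg : IsStdComplexGaussianSeq P g)
    (hlim : ∀ᵐ ω ∂P, Tendsto (fun N : ℕ => ∑ n ∈ Finset.range N, g n ω • x n) atTop (𝓝 (ξ ω)))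
    {ε : ℝ} (hε : 0 < ε) :
    ∃ N₀ : ℕ, ∀ M, N₀ ≤ M →
      eLpNorm (fun ω => ξ ω - ∑ n ∈ Finset.range M, g n ω • x n) 2 P ≤ ENNReal.ofReal ε := by
  obtain ⟨N₀, h⟩ := hg.exists_tail_le hlim hε
  refine ⟨N₀, fun M hM => ?_⟩
  refine Lp.eLpNorm_le_of_ae_tendsto (u := atTop)
    (f := fun N ω => ∑ n ∈ Finset.range N, g n ω • x n - ∑ n ∈ Finset.range M, g n ω • x n)
    ?_ (fun N => ((hg.memLp_sum _).sub (hg.memLp_sum _)).1) ?_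
  · filter_upwards [eventually_ge_atTop M] with N hN
    have := (h M N hM hN).2
    simp_rw [Finset.sum_Ico_eq_sub _ hN] at this
    exact this
  · filter_upwards [hlim] with ω hω using hω.sub_const _

theorem memLp_limit (hg : IsStdComplexGaussianSeq P g)
    (hlim : ∀ᵐ ω ∂P, Tendsto (fun N : ℕ => ∑ n ∈ Finset.range N, g n ω • x n) atTop (𝓝 (ξ ω)))
    (hξ : AEMeasurable ξ P) : MemLp ξ 2 P := by
  obtain ⟨N, hN⟩ := hg.exists_eLpNorm_sub_le hlim one_pos
  have h1 : MemLp (fun ω => ξ ω - ∑ n ∈ Finset.range N, g n ω • x n) 2 P :=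
    ⟨hξ.aestronglyMeasurable.sub (hg.memLp_sum _).1, (hN N le_rfl).trans_lt ENNReal.ofReal_lt_top⟩
  have := h1.add (hg.memLp_sum (x := x) (Finset.range N))
  refine (memLp_congr_ae (ae_of_all _ fun ω => ?_)).1 this
  simp

/-- Convergence in `L²` of the scalar series obtained by applying a functional. -/
theorem tendsto_sum_toLp (hg : IsStdComplexGaussianSeq P g)
    (hlim : ∀ᵐ ω ∂P, Tendsto (fun N : ℕ => ∑ n ∈ Finset.range N, g n ω • x n) atTop (𝓝 (ξ ω)))
    (hξ : AEMeasurable ξ P) (y : StrongDual ℂ X) :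
    Tendsto (fun N : ℕ => ∑ n ∈ Finset.range N, y (x n) • (hg.memLp n).toLp (g n)) atTop
      (𝓝 ((y.comp_memLp' (hg.memLp_limit hlim hξ)).toLp (y ∘ ξ))) := by
  have hsum : ∀ N : ℕ, ∑ n ∈ Finset.range N, y (x n) • (hg.memLp n).toLp (g n) =
      (y.comp_memLp' (hg.memLp_sum (x := x) (Finset.range N))).toLp
        (y ∘ fun ω => ∑ n ∈ Finset.range N, g n ω • x n) := by
    intro N
    apply Lp.ext
    refine EventuallyEq.trans ?_ (MemLp.coeFn_toLp _).symm
    have h2 : ∀ᵐ ω ∂P, ∀ n, (hg.memLp n).toLp (g n) ω = g n ω :=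
      ae_all_iff.2 fun n => (hg.memLp n).coeFn_toLp
    have h3 : ∀ᵐ ω ∂P, ∀ n, (y (x n) • (hg.memLp n).toLp (g n)) ω =
        y (x n) • (hg.memLp n).toLp (g n) ω := ae_all_iff.2 fun n => Lp.coeFn_smul _ _
    filter_upwards [Lp.coeFn_finsetSum (Finset.range N) fun n => y (x n) • (hg.memLp n).toLp (g n),
      h2, h3] with ω h1 h2 h3
    rw [h1, Finset.sum_apply, Function.comp_apply, map_sum]
    refine Finset.sum_congr rfl fun n _ => ?_
    rw [h3, h2, map_smul, smul_eq_mul, smul_eq_mul, mul_comm]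
  simp_rw [hsum]
  rw [Metric.tendsto_atTop]
  intro ε hε
  obtain ⟨N₀, hN₀⟩ := hg.exists_eLpNorm_sub_le hlim (ε := ε / (2 * (‖y‖ + 1))) (by positivity)
  refine ⟨N₀, fun N hN => ?_⟩
  rw [dist_comm, dist_eq_norm, ← MemLp.toLp_sub, Lp.norm_toLp]
  have h1 := eLpNorm_le_mul_eLpNorm_of_ae_le_mul
    (f := (y ∘ ξ) - (y ∘ fun ω => ∑ n ∈ Finset.range N, g n ω • x n))
    (g := fun ω => ξ ω - ∑ n ∈ Finset.range N, g n ω • x n) (c := ‖y‖) (μ := P)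
    (ae_of_all _ fun ω => by
      simp only [Pi.sub_apply, Function.comp_apply, ← map_sub]
      exact y.le_opNorm _) 2
  have h2 := h1.trans (mul_le_mul_right (hN₀ N hN) _)
  rw [← ENNReal.ofReal_mul (norm_nonneg _)] at h2
  refine (ENNReal.toReal_le_of_le_ofReal (by positivity) h2).trans_lt ?_
  rw [mul_div_assoc', div_lt_iff₀ (by positivity)]
  nlinarith [norm_nonneg y]

end IsStdComplexGaussianSeq

end Series

/-! ### Characters of the circle -/

section Characters

/-- The character `z ↦ z ^ k` of the circle. -/
def circleChar (k : ℤ) : C(Circle, ℂ) :=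
  ⟨fun z => ((z ^ k : Circle) : ℂ), continuous_subtype_val.comp (continuous_zpow k)⟩

theorem circleChar_apply (k : ℤ) (z : Circle) : circleChar k z = ((z ^ k : Circle) : ℂ) := rfl

theorem circleChar_add (k l : ℤ) (z : Circle) :
    circleChar (k + l) z = circleChar k z * circleChar l z := by
  simp [circleChar_apply, zpow_add]

theorem circleChar_neg (k : ℤ) (z : Circle) :
    circleChar (-k) z = (starRingEnd ℂ) (circleChar k z) := by
  simp [circleChar_apply, ← Circle.coe_inv_eq_conj]

theorem circleChar_one (z : Circle) : circleChar 1 z = z := by simp [circleChar_apply]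

/-- The star subalgebra of trigonometric polynomials. -/
def trigSubalgebra : StarSubalgebra ℂ C(Circle, ℂ) where
  toSubalgebra := Algebra.adjoin ℂ (Set.range circleChar)
  star_mem' := by
    change Algebra.adjoin ℂ (Set.range circleChar) ≤ star (Algebra.adjoin ℂ (Set.range circleChar))
    refine Algebra.adjoin_le ?_
    rintro - ⟨n, rfl⟩
    exact Algebra.subset_adjoin ⟨-n, ContinuousMap.ext fun z => circleChar_neg n z⟩

theorem trigSubalgebra_coe :
    Subalgebra.toSubmodule trigSubalgebra.toSubalgebra =
      Submodule.span ℂ (Set.range circleChar) := by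
  apply Algebra.adjoin_eq_span_of_subset
  refine Set.Subset.trans ?_ Submodule.subset_span
  intro x hx
  refine Submonoid.closure_induction (fun _ => id) ⟨0, ?_⟩ ?_ hx
  · ext1 z; simp [circleChar_apply]
  · rintro - - - - ⟨m, rfl⟩ ⟨n, rfl⟩
    refine ⟨m + n, ?_⟩
    ext1 z
    exact circleChar_add m n z

theorem span_circleChar_closure_eq_top :
    (Submodule.span ℂ (Set.range circleChar)).topologicalClosure = ⊤ := by
  have hsep : trigSubalgebra.SeparatesPoints := by
    intro x y hxy
    refine ⟨_, ⟨circleChar 1, Algebra.subset_adjoin ⟨1, rfl⟩, rfl⟩, ?_⟩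
    simp only [circleChar_one]
    exact fun h => hxy (Subtype.coe_injective h)
  rw [← trigSubalgebra_coe]
  exact congr_arg (Subalgebra.toSubmodule <| StarSubalgebra.toSubalgebra ·)
    (ContinuousMap.starSubalgebra_topologicalClosure_eq_top_of_separatesPoints trigSubalgebra hsep)

variable (σ : Measure Circle) [IsFiniteMeasure σ]

/-- The character `z ↦ z ^ k` as an element of `L²(σ)`. -/
def charLp (k : ℤ) : Lp ℂ 2 σ := ContinuousMap.toLp 2 σ ℂ (circleChar k)

theorem coeFn_charLp (k : ℤ) : charLp σ k =ᵐ[σ] circleChar k := ContinuousMap.coeFn_toLp _ _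

theorem dense_span_charLp : Dense (Submodule.span ℂ (Set.range (charLp σ)) : Set (Lp ℂ 2 σ)) := by
  have h1 := ContinuousMap.toLp_denseRange (p := 2) ℂ σ ℂ (by simp)
  have h2 : Dense (Submodule.span ℂ (Set.range circleChar) : Set C(Circle, ℂ)) := by
    rw [Submodule.dense_iff_topologicalClosure_eq_top]
    exact span_circleChar_closure_eq_top
  have h3 := h1.dense_image (ContinuousMap.toLp 2 σ ℂ).continuous h2
  refine h3.mono ?_
  rintro _ ⟨f, hf, rfl⟩
  have h4 : Submodule.span ℂ (Set.range (charLp σ)) = (Submodule.span ℂ (Set.range circleChar)).map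
      (ContinuousMap.toLp 2 σ ℂ).toLinearMap := by
    rw [Submodule.map_span, ← Set.range_comp]
    rfl
  rw [h4]
  exact ⟨f, hf, rfl⟩

theorem inner_charLp (k : ℤ) (F : Lp ℂ 2 σ) :
    inner ℂ (charLp σ k) F = ∫ z, circleChar (-k) z * F z ∂σ := by
  rw [L2.inner_def]
  refine integral_congr_ae ?_
  filter_upwards [coeFn_charLp σ k] with z hz
  rw [hz, circleChar_neg]
  simp [mul_comm]

theorem inner_charLp_charLp (k l : ℤ) :
    inner ℂ (charLp σ k) (charLp σ l) = ∫ z, circleChar (l - k) z ∂σ := by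
  rw [inner_charLp]
  refine integral_congr_ae ?_
  filter_upwards [coeFn_charLp σ l] with z hz
  rw [hz, ← circleChar_add]
  congr 2
  ring

theorem eq_of_forall_inner_charLp {F G : Lp ℂ 2 σ}
    (h : ∀ k, inner ℂ (charLp σ k) F = inner ℂ (charLp σ k) G) : F = G := by
  have key : ∀ v ∈ Submodule.span ℂ (Set.range (charLp σ)), inner ℂ v F = inner ℂ v G := by
    intro v hv
    induction hv using Submodule.span_induction with
    | mem x hx => obtain ⟨k, rfl⟩ := hx; exact h k
    | zero => simp
    | add x y _ _ hx hy => rw [inner_add_left, inner_add_left, hx, hy]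
    | smul c x _ hx => rw [inner_smul_left, inner_smul_left, hx]
  exact (dense_span_charLp σ).eq_of_inner_right ℂ key

/-- The normalized Haar measure of the circle. -/
def circleHaar : Measure Circle := Measure.haarMeasure ⊤

instance instIsProbabilityMeasureCircleHaar : IsProbabilityMeasure circleHaar :=
  ⟨Measure.haarMeasure_self (G := Circle) (K₀ := ⊤)⟩

theorem integral_circleChar_circleHaar (k : ℤ) :
    ∫ z, circleChar k z ∂circleHaar = if k = 0 then 1 else 0 := by
  split_ifs with hk
  · subst hk; simp [circleChar_apply]
  · have : circleHaar.IsMulLeftInvariant := by unfold circleHaar; infer_instance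
    -- Chosen so that `w ^ k = -1`; translation by `w` then turns the integral into its opposite.
    let w : Circle := Circle.exp (Real.pi / k)
    have hw : circleChar k w = -1 := by
      have : w ^ k = Circle.exp Real.pi := by
        rw [← Circle.exp_zsmul]
        congr 1
        have : (k : ℝ) ≠ 0 := by exact_mod_cast hk
        simp; field_simp
      rw [circleChar_apply, this]; simp [Circle.coe_exp]
    have h1 := integral_mul_left_eq_self (μ := circleHaar) (fun z => circleChar k z) w
    have h2 : ∀ z, circleChar k (w * z) = - circleChar k z := by
      intro z
      have : circleChar k (w * z) = circleChar k w * circleChar k z := by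
        simp [circleChar_apply, mul_zpow]
      rw [this, hw, neg_one_mul]
    simp_rw [h2, integral_neg] at h1
    exact self_eq_neg.1 h1.symm

/-- These are the Fejér weights at frequency `k`: at most `2 * |k|` indices near the ends of the
range are lost. -/
theorem tendsto_card_filter_div (k : ℤ) :
    Tendsto (fun N : ℕ => (N : ℂ)⁻¹ *
      ((Finset.range N).filter fun i : ℕ => 0 ≤ i + k ∧ i + k < N).card) atTop (𝓝 1) := by
  have h1 : Tendsto (fun N : ℕ => (N : ℝ)⁻¹ *
      ((Finset.range N).filter fun i : ℕ => 0 ≤ i + k ∧ i + k < N).card) atTop (𝓝 1) := by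
    have hlow : Tendsto (fun N : ℕ => 1 - (N : ℝ)⁻¹ * (2 * k.natAbs : ℕ)) atTop (𝓝 1) := by
      simpa using (tendsto_inv_atTop_nhds_zero_nat (𝕜 := ℝ)).mul_const ((2 * k.natAbs : ℕ) : ℝ)
        |>.const_sub 1
    refine tendsto_of_tendsto_of_tendsto_of_le_of_le' hlow tendsto_const_nhds ?_ ?_
    · filter_upwards [eventually_gt_atTop 0] with N hN
      have h2 : (Finset.range N) ⊆ ((Finset.range N).filter fun i : ℕ => 0 ≤ i + k ∧ i + k < N) ∪
          (Finset.range k.natAbs ∪ Finset.Ico (N - k.natAbs) N) := by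
        intro i hi
        simp only [Finset.mem_union, Finset.mem_filter, Finset.mem_range, Finset.mem_Ico] at hi ⊢
        omega
      have h3 := Finset.card_le_card h2
      have h4 : N ≤ ((Finset.range N).filter fun i : ℕ => 0 ≤ i + k ∧ i + k < N).card +
          2 * k.natAbs := by
        refine (Finset.card_range N ▸ h3).trans ((Finset.card_union_le _ _).trans ?_)
        gcongr
        refine (Finset.card_union_le _ _).trans ?_
        rw [Finset.card_range, Nat.card_Ico]
        omega
      have h5 : (N : ℝ) ≤ ((Finset.range N).filter fun i : ℕ => 0 ≤ i + k ∧ i + k < N).card +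
          (2 * k.natAbs : ℕ) := by exact_mod_cast h4
      have hN' : (0 : ℝ) < N := by exact_mod_cast hN
      have h6 := mul_le_mul_of_nonneg_left h5 (inv_nonneg.2 hN'.le)
      rw [inv_mul_cancel₀ hN'.ne', mul_add] at h6
      linarith
    · filter_upwards [eventually_gt_atTop 0] with N hN
      have hN' : (0 : ℝ) < N := by exact_mod_cast hN
      rw [inv_mul_le_one₀ hN']
      exact_mod_cast (Finset.card_filter_le _ _).trans (Finset.card_range N).le
  have := (Complex.continuous_ofReal.tendsto 1).comp h1
  simpa [Function.comp_def] using this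

end Characters

/-! ### Spectral measures of isometries -/

section Isometry

/-- The Fejér densities of the spectral measure of `h`. -/
def fejerDensity {H : Type*} [NormedAddCommGroup H] [InnerProductSpace ℂ H] (V : H →L[ℂ] H) (h : H) (N : ℕ)
    (z : Circle) : ℝ≥0 :=
  (N : ℝ≥0)⁻¹ * ‖∑ j ∈ Finset.range N, circleChar (-j) z • (V ^ j) h‖₊ ^ 2

theorem continuous_fejerDensity {H : Type*} [NormedAddCommGroup H]
    [InnerProductSpace ℂ H] (V : H →L[ℂ] H) (h : H) (N : ℕ) :
    Continuous (fejerDensity V h N) := by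
  have h1 : Continuous fun z : Circle => ∑ j ∈ Finset.range N, circleChar (-j) z • (V ^ j) h :=
    continuous_finsetSum _ fun j _ => (circleChar (-j)).continuous.smul continuous_const
  exact continuous_const.mul (h1.nnnorm.pow 2)

variable {H : Type*} [NormedAddCommGroup H] [InnerProductSpace ℂ H] [CompleteSpace H]

/-- The compressions of the powers of the unitary extension of an isometry `V`: the operator `V ^ k`
for `k ≥ 0`, and `(V*) ^ (-k)` for `k ≤ 0`. -/
def dilationPow (V : H →L[ℂ] H) (k : ℤ) : H →L[ℂ] H := star V ^ (-k).toNat * V ^ k.toNat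

variable {V : H →L[ℂ] H}

/-- Cancelling `V* V = 1` in the middle leaves only the difference of the exponents. The Gram matrix
of the orbit is therefore Toeplitz, as for characters. -/
theorem star_pow_mul_pow (hV : star V * V = 1) (m n : ℕ) : star V ^ m * V ^ n = dilationPow V (n - m) := by
  have h : ∀ d : ℕ, star V ^ d * V ^ d = 1 := by
    intro d
    induction d with
    | zero => simp
    | succ d ih => rw [pow_succ, pow_succ', mul_assoc, ← mul_assoc (star V) V, hV, one_mul, ih]
  rcases le_total m n with hmn | hmn
  · obtain ⟨d, rfl⟩ := Nat.exists_eq_add_of_le hmn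
    rw [pow_add, ← mul_assoc, h, one_mul]
    simp [dilationPow]
  · obtain ⟨d, rfl⟩ := Nat.exists_eq_add_of_le hmn
    rw [add_comm n d, pow_add, mul_assoc, h, mul_one]
    simp [dilationPow]

theorem inner_pow_pow (hV : star V * V = 1) (m n : ℕ) (h : H) :
    inner ℂ ((V ^ m) h) ((V ^ n) h) = inner ℂ h (dilationPow V (n - m) h) := by
  rw [← star_pow_mul_pow hV, mul_apply_eq_comp, ← star_pow,
    ContinuousLinearMap.star_eq_adjoint, ContinuousLinearMap.adjoint_inner_right]

theorem star_apply_dilationPow (hV : star V * V = 1) (k : ℤ) (h : H) :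
    star V (dilationPow V k h) = dilationPow V (k - 1) h := by
  rw [dilationPow, ← mul_apply_eq_comp, ← mul_assoc, ← pow_succ',
    star_pow_mul_pow hV]
  congr 2
  omega

theorem norm_star_pow_apply_le (hV : star V * V = 1) (m : ℕ) (u : H) : ‖(star V ^ m) u‖ ≤ ‖u‖ := by
  have h1 : ‖star V‖ ≤ 1 := by
    have : ‖V‖ * ‖V‖ ≤ 1 := by
      rw [← CStarRing.norm_star_mul_self, hV]
      exact ContinuousLinearMap.norm_id_le
    rw [norm_star]
    nlinarith [norm_nonneg V]
  calc ‖(star V ^ m) u‖ ≤ ‖star V ^ m‖ * ‖u‖ := ContinuousLinearMap.le_opNorm _ _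
    _ ≤ 1 * ‖u‖ := by
      gcongr
      induction m with
      | zero => rw [pow_zero]; exact ContinuousLinearMap.norm_id_le
      | succ m ih =>
        rw [pow_succ]
        exact (norm_mul_le _ _).trans (mul_le_one₀ ih (norm_nonneg _) h1)
    _ = ‖u‖ := one_mul _

theorem fejerDensity_eq (hV : star V * V = 1) (h : H) (N : ℕ) (z : Circle) :
    (fejerDensity V h N z : ℂ) = (N : ℂ)⁻¹ * ∑ i ∈ Finset.range N, ∑ j ∈ Finset.range N,
      circleChar (i - j) z * inner ℂ h (dilationPow V (j - i) h) := by
  have h1 : ((‖∑ j ∈ Finset.range N, circleChar (-j) z • (V ^ j) h‖ ^ 2 : ℝ) : ℂ) =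
      ∑ i ∈ Finset.range N, ∑ j ∈ Finset.range N,
      circleChar (i - j) z * inner ℂ h (dilationPow V (j - i) h) := by
    rw [Complex.ofReal_pow]
    refine (inner_self_eq_norm_sq_to_K (𝕜 := ℂ)
      (∑ j ∈ Finset.range N, circleChar (-j) z • (V ^ j) h)).symm.trans ?_
    rw [sum_inner]
    refine Finset.sum_congr rfl fun i _ => ?_
    rw [inner_sum]
    refine Finset.sum_congr rfl fun j _ => ?_
    rw [inner_smul_left, inner_smul_right, inner_pow_pow hV, ← circleChar_neg, neg_neg, ← mul_assoc,
      ← circleChar_add, ← sub_eq_add_neg]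
  rw [← h1]
  simp [fejerDensity]

/-- By orthogonality of characters only the pairs with `j = i + k` survive, and they all contribute
the same inner product. -/
theorem integral_circleChar_fejer (hV : star V * V = 1) (h : H) (N : ℕ) (k : ℤ) :
    ∫ z, circleChar k z ∂circleHaar.withDensity (fun z => fejerDensity V h N z) =
      ((N : ℂ)⁻¹ * ((Finset.range N).filter fun i : ℕ => 0 ≤ i + k ∧ i + k < N).card) *
        inner ℂ h (dilationPow V k h) := by
  rw [integral_withDensity_eq_integral_smul (continuous_fejerDensity V h N).measurable]
  have h1 : ∀ z, fejerDensity V h N z • circleChar k z =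
      ∑ i ∈ Finset.range N, ∑ j ∈ Finset.range N, circleChar (i - j + k) z *
        ((N : ℂ)⁻¹ * inner ℂ h (dilationPow V (j - i) h)) := by
    intro z
    rw [NNReal.smul_def, Complex.real_smul, fejerDensity_eq hV, Finset.mul_sum, Finset.sum_mul]
    refine Finset.sum_congr rfl fun i _ => ?_
    rw [Finset.mul_sum, Finset.sum_mul]
    refine Finset.sum_congr rfl fun j _ => ?_
    rw [circleChar_add]; ring
  have hint : ∀ (l : ℤ) (c : ℂ), Integrable (fun z => circleChar l z * c) circleHaar := fun l c =>
    ((circleChar l).continuous.mul continuous_const).integrable_of_hasCompactSupport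
      (HasCompactSupport.of_compactSpace _)
  simp_rw [h1]
  rw [integral_finsetSum _ fun i _ => integrable_finsetSum _ fun j _ => hint _ _,
    Finset.card_filter, Nat.cast_sum, Finset.mul_sum, Finset.sum_mul]
  refine Finset.sum_congr rfl fun i _ => ?_
  rw [integral_finsetSum _ fun j _ => hint _ _]
  simp_rw [integral_mul_const, integral_circleChar_circleHaar]
  split_ifs with hik
  · rw [Finset.sum_eq_single (i + k).toNat]
    · rw [if_pos (by omega), show ((i + k).toNat : ℤ) - i = k by omega]; simp
    · intro j _ hj
      rw [if_neg (by omega), zero_mul]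
    · intro hj
      exact absurd (Finset.mem_range.2 (by omega)) hj
  · rw [Finset.sum_eq_zero]
    · simp
    · intro j hj
      have := Finset.mem_range.1 hj
      rw [if_neg (by omega), zero_mul]

/-- Herglotz' theorem, for the correlation sequence of a vector under an isometry. -/
theorem exists_spectral_measure (hV : star V * V = 1) (h : H) :
    ∃ σ : Measure Circle, IsFiniteMeasure σ ∧
      ∀ k : ℤ, ∫ z, circleChar k z ∂σ = inner ℂ h (dilationPow V k h) := by
  have hfin : ∀ N, IsFiniteMeasure (circleHaar.withDensity fun z => fejerDensity V h N z) := by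
    intro N
    refine isFiniteMeasure_withDensity ?_
    exact (BoundedContinuousFunction.lintegral_lt_top_of_nnreal circleHaar
      (BoundedContinuousFunction.mkOfCompact ⟨_, continuous_fejerDensity V h N⟩)).ne
  let ν : ℕ → FiniteMeasure Circle := fun N => ⟨_, hfin N⟩
  have hmass : ∀ N, (ν N).mass ≤ ‖h‖₊ ^ 2 := by
    intro N
    have h1 := integral_circleChar_fejer hV h N 0
    have h2 : ∀ z, circleChar 0 z = 1 := fun z => by simp [circleChar_apply]
    have h3 : dilationPow V 0 h = h := by simp [dilationPow]
    simp only [h2, h3, integral_const, inner_self_eq_norm_sq_to_K] at h1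
    have h4 : ((circleHaar.withDensity fun z => fejerDensity V h N z).real Set.univ : ℂ) = (((N : ℝ)⁻¹ * ((Finset.range N).filter
        fun i : ℕ => 0 ≤ (i : ℤ) + 0 ∧ (i : ℤ) + 0 < N).card * ‖h‖ ^ 2 : ℝ) : ℂ) := by
      simpa using h1
    have h5 : (circleHaar.withDensity fun z => fejerDensity V h N z).real Set.univ ≤ ‖h‖ ^ 2 := by
      rw [Complex.ofReal_inj.1 h4]
      refine mul_le_of_le_one_left (by positivity) ?_
      refine (mul_le_mul_of_nonneg_left (?_ : _ ≤ (N : ℝ)) (by positivity)).trans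
        (inv_mul_le_one (a := (N : ℝ)))
      exact_mod_cast (Finset.card_filter_le _ _).trans (Finset.card_range N).le
    exact_mod_cast h5
  -- Measures of mass at most `‖h‖ ^ 2` form a weakly compact set. A limit along a nonprincipal
  -- ultrafilter suffices, since the moments already converge along `atTop`.
  obtain ⟨σ, -, hσ⟩ := (isCompact_setOfPred_finiteMeasure_le_of_compactSpace Circle
    (‖h‖₊ ^ 2)).ultrafilter_le_nhds ((hyperfilter ℕ).map ν) (by
      simp only [le_principal_iff]
      exact Filter.mem_map.2 (Filter.Eventually.of_forall hmass))
  refine ⟨σ, inferInstance, fun k => ?_⟩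
  have h1 : Tendsto ν (hyperfilter ℕ) (𝓝 σ) := hσ
  rw [FiniteMeasure.tendsto_iff_forall_integral_rclike_tendsto ℂ] at h1
  have h2 := h1 (BoundedContinuousFunction.mkOfCompact (circleChar k))
  have h3 := ((tendsto_card_filter_div k).mul_const
    (inner ℂ h (dilationPow V k h))).mono_left (Nat.hyperfilter_le_atTop)
  rw [one_mul] at h3
  refine tendsto_nhds_unique (h2.congr fun N => ?_) h3
  exact integral_circleChar_fejer hV h N k

end Isometry

/-! ### The `L²(σ)` model of an isometry. -/

section Model

theorem norm_linearCombination_eq_of_inner_eq {ι E F : Type*} [NormedAddCommGroup E]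
    [InnerProductSpace ℂ E] [NormedAddCommGroup F] [InnerProductSpace ℂ F] {u : ι → E} {v : ι → F}
    (c : ι →₀ ℂ) (h : ∀ i ∈ c.support, ∀ j ∈ c.support, inner ℂ (u i) (u j) = inner ℂ (v i) (v j)) :
    ‖Finsupp.linearCombination ℂ u c‖ = ‖Finsupp.linearCombination ℂ v c‖ := by
  have key : inner ℂ (Finsupp.linearCombination ℂ u c) (Finsupp.linearCombination ℂ u c) =
      inner ℂ (Finsupp.linearCombination ℂ v c) (Finsupp.linearCombination ℂ v c) := by
    simp only [Finsupp.linearCombination_apply, Finsupp.sum, sum_inner, inner_sum,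
      inner_smul_left, inner_smul_right]
    refine Finset.sum_congr rfl fun i hi => congrArg _ (Finset.sum_congr rfl fun j hj => ?_)
    rw [h j hj i hi]
  rw [@norm_eq_sqrt_re_inner ℂ, @norm_eq_sqrt_re_inner ℂ, key]

theorem memLp_circle_mul {σ : Measure Circle} {F : Circle → ℂ} (hF : MemLp F 2 σ) :
    MemLp (fun z : Circle => (z : ℂ) * F z) 2 σ := by
  refine (memLp_congr_norm
    ((show Continuous fun z : Circle => (z : ℂ) by fun_prop).aestronglyMeasurable.mul hF.1) hF.1 ?_).2 hF
  filter_upwards with z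
  change ‖(z : ℂ) * F z‖ = _
  rw [norm_mul, Circle.norm_coe, one_mul]

variable {H : Type*} [NormedAddCommGroup H] [InnerProductSpace ℂ H] [CompleteSpace H]
  {V : H →L[ℂ] H}

/-- The spectral model of an isometry `V` at a vector `h`: a contraction from the Hilbert space to
`L²(σ)`, where `σ` is the spectral measure of `h`, which maps `h` to the constant function `1` and
intertwines `V` with the multiplication by the variable. -/
theorem exists_spectral_model (hV : star V * V = 1) (h : H) :
    ∃ (σ : Measure Circle) (_ : IsFiniteMeasure σ) (J : H →L[ℂ] Lp ℂ 2 σ),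
      (∀ k : ℤ, ∫ z, circleChar k z ∂σ = inner ℂ h (dilationPow V k h)) ∧
      (∀ u, ‖J u‖ ≤ ‖u‖) ∧ (∀ᵐ z ∂σ, J h z = 1) ∧
      ∀ u, ∀ᵐ z ∂σ, J (V u) z = z * J u z := by
  obtain ⟨σ, hσ, hmom⟩ := exists_spectral_measure hV h
  let e : (ℤ →₀ ℂ) →ₗ[ℂ] Lp ℂ 2 σ := Finsupp.linearCombination ℂ (charLp σ)
  let f : (ℤ →₀ ℂ) →ₗ[ℂ] H := Finsupp.linearCombination ℂ fun k => dilationPow V k h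
  have he : DenseRange e := by
    have := dense_span_charLp σ
    rw [← Finsupp.range_linearCombination] at this
    exact this
  have hfe : ∀ c, ‖f c‖ ≤ 1 * ‖e c‖ := by
    intro c
    -- After a shift by `m` all exponents in the support are nonnegative. The orbit vectors `V ^ (k
    -- + m) h` have the same Gram matrix as the characters, and the contraction `(V*) ^ m` shifts
    -- back.
    obtain ⟨m, hm⟩ : ∃ m : ℕ, ∀ k ∈ c.support, 0 ≤ k + m := by
      refine ⟨c.support.sup Int.natAbs, fun k hk => ?_⟩
      have := Finset.le_sup (f := Int.natAbs) hk
      omega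
    have h1 : f c = (star V ^ m) (Finsupp.linearCombination ℂ
        (fun k : ℤ => (V ^ (k + m).toNat) h) c) := by
      simp only [f, Finsupp.linearCombination_apply, Finsupp.sum, map_sum, map_smul]
      refine Finset.sum_congr rfl fun k hk => ?_
      rw [← mul_apply_eq_comp, star_pow_mul_pow hV]
      congr 3
      have := hm k hk
      omega
    have h2 : ‖Finsupp.linearCombination ℂ (fun k : ℤ => (V ^ (k + m).toNat) h) c‖ = ‖e c‖ := by
      refine norm_linearCombination_eq_of_inner_eq c fun k hk l hl => ?_
      rw [inner_pow_pow hV, inner_charLp_charLp, hmom]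
      congr 3
      have := hm k hk
      have := hm l hl
      omega
    rw [h1, one_mul, ← h2]
    exact norm_star_pow_apply_le hV m _
  -- `W` sends `z ^ k` to `dilationPow V k h` and extends by density of trigonometric polynomials;
  -- the required `J` is its adjoint.
  let W : Lp ℂ 2 σ →L[ℂ] H := f.extendOfNorm e
  have hW : ∀ k, W (charLp σ k) = dilationPow V k h := by
    intro k
    have := LinearMap.extendOfNorm_eq he ⟨1, hfe⟩ (Finsupp.single k 1)
    simpa [e, f] using this
  have hW1 : ‖W‖ ≤ 1 := W.opNorm_le_bound zero_le_one fun F =>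
    LinearMap.norm_extendOfNorm_apply_le he 1 hfe F
  refine ⟨σ, hσ, W.adjoint, hmom, fun u => ?_, ?_, fun u => ?_⟩
  · have : ‖W.adjoint‖ ≤ 1 := by rwa [LinearIsometryEquiv.norm_map]
    simpa using W.adjoint.le_of_opNorm_le this u
  · have h1 : W.adjoint h = charLp σ 0 := by
      refine eq_of_forall_inner_charLp σ fun k => ?_
      rw [ContinuousLinearMap.adjoint_inner_right, hW, inner_charLp_charLp, ← inner_conj_symm,
        ← hmom, ← integral_conj, zero_sub]
      simp_rw [circleChar_neg]
    rw [h1]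
    filter_upwards [coeFn_charLp σ 0] with z hz
    rw [hz]; simp [circleChar_apply]
  · have hm := memLp_circle_mul (Lp.memLp (W.adjoint u))
    -- Tested against `z ^ k`: moving `V` across the inner product applies `V*` to `W z ^ k`, which
    -- lowers the exponent by one.
    have h1 : W.adjoint (V u) = hm.toLp _ := by
      refine eq_of_forall_inner_charLp σ fun k => ?_
      rw [ContinuousLinearMap.adjoint_inner_right, hW, ← ContinuousLinearMap.adjoint_inner_left,
        ← ContinuousLinearMap.star_eq_adjoint, star_apply_dilationPow hV, ← hW,
        ← ContinuousLinearMap.adjoint_inner_right, inner_charLp, inner_charLp]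
      refine integral_congr_ae ?_
      filter_upwards [hm.coeFn_toLp] with z hz
      rw [hz, ← circleChar_one z, ← mul_assoc, ← circleChar_add,
        show -k + 1 = -(k - 1) by ring]
    rw [h1]
    exact hm.coeFn_toLp

end Model

/-! ### Positive measures as complex measures -/

section ComplexMeasure

variable (σ : Measure Circle) [IsFiniteMeasure σ]

/-- A finite positive measure on the circle, as a complex measure. -/
def complexOfMeasure : ComplexMeasure Circle := σ.toSignedMeasure.toComplexMeasure 0

theorem complexOfMeasure_apply {A : Set Circle} (hA : MeasurableSet A) :
    complexOfMeasure σ A = (σ.real A : ℂ) := by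
  rw [complexOfMeasure, SignedMeasure.toComplexMeasure_apply,
    Measure.toSignedMeasure_apply_measurable hA]
  rfl

theorem isPositiveMeasure_complexOfMeasure : IsPositiveMeasure (complexOfMeasure σ) := by
  intro A hA
  rw [complexOfMeasure_apply σ hA]
  simp

theorem variation_complexOfMeasure : (complexOfMeasure σ).variation = σ := by
  apply le_antisymm
  · refine VectorMeasure.variation_le_of_forall_enorm_le fun A hA => ?_
    simp [complexOfMeasure_apply σ hA, Measure.real, ← ofReal_norm]
  · refine Measure.le_iff.2 fun A hA => ?_
    refine le_trans ?_ (VectorMeasure.enorm_measure_le_variation _ _)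
    simp [complexOfMeasure_apply σ hA, Measure.real, ← ofReal_norm]

theorem integral_complexOfMeasure (f : Circle → ℂ) :
    (complexOfMeasure σ).integral f (ContinuousLinearMap.mul ℝ ℂ) = ∫ z, f z ∂σ := by
  rw [VectorMeasure.integral_eq_setToFun, MeasureTheory.integral_eq_setToFun]
  simp only [variation_complexOfMeasure]
  refine setToFun_congr_left' _ _ (fun A hA _ => ?_) f
  ext1 z
  change z * complexOfMeasure σ A = weightedSMul σ A z
  rw [complexOfMeasure_apply σ hA, weightedSMul_apply, Complex.real_smul, mul_comm]

theorem fourierCoeffMeasure_complexOfMeasure (n : ℤ) :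
    fourierCoeffMeasure (complexOfMeasure σ) n = ∫ z, circleChar (-n) z ∂σ :=
  integral_complexOfMeasure σ _

end ComplexMeasure

/-! ### Factorization through vector-valued functions -/

/-- A subspace annihilated by no nonzero functional is dense. -/
theorem dense_of_forall_dual_eq_zero {X : Type*} [NormedAddCommGroup X] [NormedSpace ℂ X]
    (p : Submodule ℂ X) (hp : ∀ y : StrongDual ℂ X, (∀ v ∈ p, y v = 0) → y = 0) :
    Dense (p : Set X) := by
  by_contra hne
  obtain ⟨v, hv⟩ : ∃ v, v ∉ p.topologicalClosure := by
    by_contra! h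
    exact hne (Submodule.dense_iff_topologicalClosure_eq_top.2 (eq_top_iff.2 fun v _ => h v))
  have hcl : IsClosed (p.topologicalClosure : Set X) := p.isClosed_topologicalClosure
  have hv' : p.topologicalClosure.mkQ v ≠ 0 := by simpa using hv
  obtain ⟨f, hf⟩ := SeparatingDual.exists_ne_zero (R := ℂ) hv'
  -- A functional separating `v` from zero in the quotient by the closure pulls back to one that
  -- kills `p` but not `v`.
  refine hf ?_
  have := hp (f.comp p.topologicalClosure.mkQL) fun w hw => by
    have : p.topologicalClosure.mkQL w = 0 := by
      simpa using p.le_topologicalClosure hw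
    simp [this]
  exact congr($this v)

namespace IsStdComplexGaussianSeq

variable {Ω : Type*} [MeasurableSpace Ω] {P : Measure Ω} {g : ℕ → Ω → ℂ}

/-- Orthonormality. The coefficients are conjugated because `inner ℂ c` is conjugate linear in `c`,
the form needed in the square function estimate. -/
theorem norm_sum_smul_toLp (hg : IsStdComplexGaussianSeq P g) (s : Finset ℕ)
    (c : EuclideanSpace ℂ s) :
    ‖∑ i, star (c i) • (hg.memLp i).toLp (g i)‖ = ‖c‖ := by
  have h := (hg.orthonormal.comp ((↑) : s → ℕ) Subtype.val_injective).inner_sum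
    (fun i => star (c i)) (fun i => star (c i)) Finset.univ
  simp only [Function.comp_apply] at h
  rw [inner_self_eq_norm_sq_to_K] at h
  have h2 : (‖∑ i, star (c i) • (hg.memLp i).toLp (g i)‖ : ℂ) ^ 2 = ((‖c‖ ^ 2 : ℝ) : ℂ) := by
    rw [EuclideanSpace.norm_sq_eq]
    refine h.trans ?_
    push_cast
    refine Finset.sum_congr rfl fun i _ => ?_
    rw [Complex.conj_mul', norm_star]
  have h3 : ‖∑ i, star (c i) • (hg.memLp i).toLp (g i)‖ ^ 2 = ‖c‖ ^ 2 := by exact_mod_cast h2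
  exact (sq_eq_sq₀ (norm_nonneg _) (norm_nonneg _)).1 h3

variable {X : Type*} [NormedAddCommGroup X] [NormedSpace ℂ X] {x : ℕ → X}
  [IsProbabilityMeasure P] [CompleteSpace X] [MeasurableSpace X] [BorelSpace X]
  [SecondCountableTopology X] {ξ : Ω → X}

/-- Integration is the inner product with the constant `1`, so it passes to the `L²` limit of the
centred partial sums. -/
theorem integral_dual_limit (hg : IsStdComplexGaussianSeq P g)
    (hlim : ∀ᵐ ω ∂P, Tendsto (fun N : ℕ => ∑ n ∈ Finset.range N, g n ω • x n) atTop (𝓝 (ξ ω)))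
    (hξ : AEMeasurable ξ P) (y : StrongDual ℂ X) : ∫ ω, y (ξ ω) ∂P = 0 := by
  have key : ∀ f : Lp ℂ 2 P,
      inner ℂ (indicatorConstLp 2 MeasurableSet.univ (measure_ne_top P _) (1 : ℂ)) f =
        ∫ ω, f ω ∂P := fun f => by rw [L2.inner_indicatorConstLp_one, setIntegral_univ]
  have h1 := (tendsto_const_nhds (x := indicatorConstLp 2 MeasurableSet.univ
    (measure_ne_top P _) (1 : ℂ))).inner (𝕜 := ℂ) (hg.tendsto_sum_toLp hlim hξ y)
  have h2 : ∀ n, ∫ ω, (hg.memLp n).toLp (g n) ω ∂P = 0 := fun n => by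
    rw [integral_congr_ae (hg.memLp n).coeFn_toLp, hg.integral_eq_zero]
  simp only [inner_sum, inner_smul_right] at h1
  simp only [key, h2, mul_zero, Finset.sum_const_zero] at h1
  rw [integral_congr_ae (MemLp.coeFn_toLp _)] at h1
  exact tendsto_nhds_unique h1 tendsto_const_nhds

/-- In a space of cotype 2, a contraction of the scalar `L²` space of a Gaussian series into another
`L²` space lifts to a vector-valued function. -/
theorem exists_compLpL_eq (hX : HasCotypeTwo X) (hg : IsStdComplexGaussianSeq P g)
    (hlim : ∀ᵐ ω ∂P, Tendsto (fun N : ℕ => ∑ n ∈ Finset.range N, g n ω • x n) atTop (𝓝 (ξ ω)))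
    (hξ : AEMeasurable ξ P) {Z : Type} [MeasurableSpace Z] (σ : Measure Z) [IsFiniteMeasure σ]
    (A : Lp ℂ 2 P →L[ℂ] Lp ℂ 2 σ) (hA : ∀ u, ‖A u‖ ≤ ‖u‖) :
    ∃ E : Lp X 2 σ, ∀ y : StrongDual ℂ X,
      y.compLpL 2 σ E = A ((y.comp_memLp' (hg.memLp_limit hlim hξ)).toLp (y ∘ ξ)) := by
  obtain ⟨C, hC0, hC⟩ := hX.exists_eLpNorm_le
  set φ : ℕ → Lp ℂ 2 σ := fun n => A ((hg.memLp n).toLp (g n)) with hφ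
  -- The candidate is `E = ∑ φ n • x n`. Since `A` is a contraction and the `g n` are orthonormal,
  -- each finite block of `φ` satisfies the weak `L²` hypothesis of the square function estimate.
  set u : ℕ → Lp X 2 σ := fun n =>
    ((ContinuousLinearMap.id ℂ ℂ).smulRight (x n)).compLpL 2 σ (φ n) with hu
  have hucoe : ∀ n, u n =ᵐ[σ] fun z => φ n z • x n := fun n =>
    ContinuousLinearMap.coeFn_compLpL _ _
  have hbound : ∀ M N, ‖∑ n ∈ Finset.Ico M N, u n‖ ≤
      C * ∫ h, ‖∑ i, h i • x i‖ ∂gaussianPi (Finset.Ico M N) := by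
    intro M N
    set F : Z → EuclideanSpace ℂ (Finset.Ico M N) := fun z => WithLp.toLp 2 fun i => φ i z with hF
    have hFm : MemLp F 2 σ := MemLp.of_eval_piLp fun i => Lp.memLp (φ i)
    have h1 := hC (Finset.Ico M N) (fun i => x i) σ F hFm fun c => by
      have h2 : (fun z => inner ℂ c (F z)) =ᵐ[σ]
          A (∑ i, star (c i) • (hg.memLp i).toLp (g i)) := by
        rw [map_sum]
        simp only [map_smul]
        have h3 : ∀ᵐ z ∂σ, ∀ i : Finset.Ico M N, (star (c i) • φ i) z = star (c i) • φ i z :=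
          ae_all_iff.2 fun i => Lp.coeFn_smul _ _
        filter_upwards [Lp.coeFn_finsetSum Finset.univ
          fun i : Finset.Ico M N => star (c i) • φ i, h3] with z h4 h3
        rw [h4, Finset.sum_apply, PiLp.inner_apply]
        refine Finset.sum_congr rfl fun i _ => ?_
        rw [h3]
        simp [hF, mul_comm]
      rw [eLpNorm_congr_ae h2, ← Lp.enorm_def, ← ofReal_norm, ← ofReal_norm,
        ← hg.norm_sum_smul_toLp]
      exact ENNReal.ofReal_le_ofReal (hA _)
    have h5 : (∑ n ∈ Finset.Ico M N, u n : Lp X 2 σ) =ᵐ[σ] fun z => ∑ i, F z i • x i := by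
      filter_upwards [Lp.coeFn_finsetSum (Finset.Ico M N) u, ae_all_iff.2 hucoe] with z h6 h7
      rw [h6, Finset.sum_apply, ← Finset.sum_coe_sort]
      exact Finset.sum_congr rfl fun i _ => h7 i
    rw [Lp.norm_def, eLpNorm_congr_ae h5]
    exact ENNReal.toReal_le_of_le_ofReal
      (mul_nonneg hC0 (integral_nonneg fun _ => norm_nonneg _)) h1
  have hcauchy : CauchySeq fun N => ∑ n ∈ Finset.range N, u n := by
    refine Metric.cauchySeq_iff'.2 fun ε hε => ?_
    obtain ⟨N₀, hN₀⟩ := hg.exists_tail_le hlim (ε := ε / (C + 1)) (by positivity)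
    refine ⟨N₀, fun N hN => ?_⟩
    rw [dist_eq_norm, ← Finset.sum_Ico_eq_sub _ hN]
    refine ((hbound N₀ N).trans (mul_le_mul_of_nonneg_left (hN₀ N₀ N le_rfl hN).1 hC0)).trans_lt ?_
    rw [mul_div_assoc', div_lt_iff₀ (by positivity)]
    nlinarith
  obtain ⟨E, hE⟩ := cauchySeq_tendsto_of_complete hcauchy
  refine ⟨E, fun y => ?_⟩
  have h1 := ((y.compLpL 2 σ).continuous.tendsto E).comp hE
  have h2 := (A.continuous.tendsto _).comp (hg.tendsto_sum_toLp hlim hξ y)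
  -- Both sides are limits of the partial sums of `∑ y (x n) • φ n`.
  refine tendsto_nhds_unique h1 (h2.congr fun N => ?_)
  simp only [Function.comp_apply, map_sum, map_smul]
  refine Finset.sum_congr rfl fun n _ => Lp.ext ?_
  filter_upwards [y.coeFn_compLpL (u n), hucoe n, Lp.coeFn_smul (y (x n)) (φ n)] with z h3 h4 h5
  rw [h3, h4, h5]
  simp [mul_comm]

end IsStdComplexGaussianSeq

/-! ### Spectral measures of the Koopman operator -/

section Koopman

variable {Y : Type*} [MeasurableSpace Y] {μ : Measure Y} {T : Y → Y}

theorem star_koopman_mul_koopman (hT : MeasurePreserving T μ μ) :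
    star (koopman hT) * koopman hT = 1 := by
  rw [ContinuousLinearMap.star_eq_adjoint]
  exact (ContinuousLinearMap.norm_map_iff_adjoint_comp_self _).1
    (Lp.compMeasurePreservingₗᵢ ℂ T hT).norm_map

theorem inner_star_star (f g : Lp ℂ 2 μ) : inner ℂ (star f) (star g) = inner ℂ g f := by
  rw [L2.inner_def, L2.inner_def]
  refine integral_congr_ae ?_
  filter_upwards [Lp.coeFn_star f, Lp.coeFn_star g] with a h1 h2
  rw [h1, h2]
  simp [mul_comm]

theorem koopman_pow_star (hT : MeasurePreserving T μ μ) (f : Lp ℂ 2 μ) (n : ℕ) :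
    (koopman hT ^ n) (star f) = star ((koopman hT ^ n) f) := by
  induction n generalizing f with
  | zero => simp
  | succ n ih =>
    rw [pow_succ, mul_apply_eq_comp, mul_apply_eq_comp, ← ih]
    congr 1
    change Lp.compMeasurePreserving T hT (star f) = star (Lp.compMeasurePreserving T hT f)
    apply Lp.ext
    filter_upwards [Lp.coeFn_compMeasurePreserving (star f) hT,
      Lp.coeFn_star (Lp.compMeasurePreserving T hT f),
      Lp.coeFn_compMeasurePreserving f hT,
      hT.quasiMeasurePreserving.ae_eq_comp (Lp.coeFn_star f)] with a h1 h2 h3 h4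
    rw [h1, h2, h4]
    exact congrArg star h3.symm

/-- The witness is `star h`, not `h`: the convention `σ̂(n) = ∫ z ^ (-n) dσ` reverses the sign of
the exponents in `hσ`, and conjugation, which commutes with the Koopman operator, restores it. -/
theorem complexOfMeasure_mem_spectralFamily (hT : MeasurePreserving T μ μ) {h : Lp ℂ 2 μ}
    (h0 : ∫ x, h x ∂μ = 0) (σ : Measure Circle) [IsFiniteMeasure σ]
    (hσ : ∀ k : ℤ, ∫ z, circleChar k z ∂σ = inner ℂ h (dilationPow (koopman hT) k h)) :
    complexOfMeasure σ ∈ spectralFamily hT := by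
  have h0' : ∫ x, (star h : Lp ℂ 2 μ) x ∂μ = 0 := by
    rw [integral_congr_ae (Lp.coeFn_star h)]
    simpa [h0] using integral_conj (f := h) (μ := μ)
  refine ⟨star h, star h, h0', h0', fun n => ⟨?_, ?_⟩⟩
  · rw [fourierCoeffMeasure_complexOfMeasure, hσ, koopman_pow_star, inner_star_star]
    have h1 : dilationPow (koopman hT) (-(n : ℤ)) =
        ContinuousLinearMap.adjoint (koopman hT ^ n) := by
      rw [← ContinuousLinearMap.star_eq_adjoint, star_pow]
      simp [dilationPow]
    rw [h1, ContinuousLinearMap.adjoint_inner_right]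
  · rw [fourierCoeffMeasure_complexOfMeasure, hσ, ← ContinuousLinearMap.star_eq_adjoint, ← star_pow,
      ContinuousLinearMap.star_eq_adjoint, ContinuousLinearMap.adjoint_inner_right,
      koopman_pow_star, inner_star_star]
    simp [dilationPow]

end Koopman

/-! ### Eigenvector fields -/

variable {X : Type*} [NormedAddCommGroup X] [NormedSpace ℂ X] [CompleteSpace X]
  [SecondCountableTopology X] [MeasurableSpace X] [BorelSpace X]

theorem IsGaussianMeasure.memLp_dual {μ : Measure X} (hμ : IsGaussianMeasure μ)
    (y : StrongDual ℂ X) : MemLp y 2 μ := by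
  obtain ⟨Ω, mΩ, P, hP, g, x, ξ, hg, hlim, hξ⟩ := hμ
  rw [← hξ.map_eq]
  exact (memLp_map_measure_iff y.continuous.aestronglyMeasurable hξ.aemeasurable).2
    (y.comp_memLp' (hg.memLp_limit hlim hξ.aemeasurable))

theorem IsGaussianMeasure.integral_dual {μ : Measure X} (hμ : IsGaussianMeasure μ)
    (y : StrongDual ℂ X) : ∫ v, y v ∂μ = 0 := by
  obtain ⟨Ω, mΩ, P, hP, g, x, ξ, hg, hlim, hξ⟩ := hμ
  rw [← hξ.map_eq, integral_map hξ.aemeasurable y.continuous.aestronglyMeasurable]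
  exact hg.integral_dual_limit hlim hξ.aemeasurable y

/-- In a space of cotype 2, a contraction of the `L²` space of a Gaussian measure into another `L²`
space lifts to a vector-valued function. -/
theorem IsGaussianMeasure.exists_forall_dual_ae_eq {μ : Measure X} (hμ : IsGaussianMeasure μ)
    (hX : HasCotypeTwo X) {Z : Type} [MeasurableSpace Z] (σ : Measure Z) [IsFiniteMeasure σ]
    (J : Lp ℂ 2 μ →L[ℂ] Lp ℂ 2 σ) (hJ : ∀ u, ‖J u‖ ≤ ‖u‖) :
    ∃ E : Z → X, MemLp E 2 σ ∧ ∀ y : StrongDual ℂ X,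
      (fun z => y (E z)) =ᵐ[σ] J ((hμ.memLp_dual y).toLp y) := by
  obtain ⟨Ω, mΩ, P, hP, g, x, ξ, hg, hlim, hξ⟩ := id hμ
  have hmp : MeasurePreserving (hξ.aemeasurable.mk ξ) P μ :=
    ⟨hξ.aemeasurable.measurable_mk, by
      rw [← Measure.map_congr hξ.aemeasurable.ae_eq_mk, hξ.map_eq]⟩
  -- Composition with `ξ` embeds `L²(μ)` isometrically in `L²(P)`. The lifting is applied to `J Γ*`,
  -- and `Γ* Γ = 1` recovers `J` on functionals.
  set Γ : Lp ℂ 2 μ →L[ℂ] Lp ℂ 2 P :=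
    (Lp.compMeasurePreservingₗᵢ ℂ (hξ.aemeasurable.mk ξ) hmp).toContinuousLinearMap with hΓ
  have hΓn : ∀ u, ‖Γ u‖ = ‖u‖ :=
    (Lp.compMeasurePreservingₗᵢ ℂ (hξ.aemeasurable.mk ξ) hmp).norm_map
  have hΓΓ : Γ.adjoint ∘L Γ = 1 := (ContinuousLinearMap.norm_map_iff_adjoint_comp_self _).1 hΓn
  have hΓ1 : ‖Γ.adjoint‖ ≤ 1 := by
    rw [LinearIsometryEquiv.norm_map]
    exact Γ.opNorm_le_bound zero_le_one fun u => by rw [hΓn, one_mul]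
  obtain ⟨E, hE⟩ := hg.exists_compLpL_eq hX hlim hξ.aemeasurable σ (J ∘L Γ.adjoint) fun u =>
    (hJ _).trans (by simpa using Γ.adjoint.le_of_opNorm_le hΓ1 u)
  refine ⟨E, Lp.memLp E, fun y => ?_⟩
  have h1 : (y.comp_memLp' (hg.memLp_limit hlim hξ.aemeasurable)).toLp (y ∘ ξ) =
      Γ ((hμ.memLp_dual y).toLp y) := by
    refine MemLp.toLp_congr _ ((hμ.memLp_dual y).comp_measurePreserving hmp) ?_
    filter_upwards [hξ.aemeasurable.ae_eq_mk] with ω hω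
    simp [← hω]
  have h2 := hE y
  rw [h1, ContinuousLinearMap.comp_apply, ← ContinuousLinearMap.comp_apply Γ.adjoint, hΓΓ] at h2
  rw [one_apply_eq_self] at h2
  rw [← h2]
  exact (y.coeFn_compLpL E).symm

/-- In a space of cotype 2, every functional has a spectral measure, with respect to an invariant
Gaussian measure, that carries a field of unimodular eigenvectors on which the functional is `1`. -/
theorem IsGaussianMeasure.exists_eigenvector_field {μ : Measure X} (hμ : IsGaussianMeasure μ)
    (hX : HasCotypeTwo X) (T : X →L[ℂ] X) (hT : MeasurePreserving T μ μ) (y : StrongDual ℂ X) :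
    ∃ (σ : Measure Circle) (_ : IsFiniteMeasure σ) (E : Circle → X),
      complexOfMeasure σ ∈ spectralFamily hT ∧
      (σ.real Set.univ : ℂ) = (‖(hμ.memLp_dual y).toLp y‖ : ℂ) ^ 2 ∧
      (∀ᵐ z ∂σ, T (E z) = (z : ℂ) • E z) ∧ ∀ᵐ z ∂σ, y (E z) = 1 := by
  set h := (hμ.memLp_dual y).toLp y with hh
  obtain ⟨σ, hσ, J, hmom, hJ, hJ1, hJV⟩ :=
    exists_spectral_model (star_koopman_mul_koopman hT) h
  obtain ⟨E, hEm, hE⟩ := hμ.exists_forall_dual_ae_eq hX σ J hJ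
  refine ⟨σ, hσ, E, complexOfMeasure_mem_spectralFamily hT ?_ σ hmom, ?_, ?_, ?_⟩
  · rw [integral_congr_ae (MemLp.coeFn_toLp _), hμ.integral_dual]
  · have := hmom 0
    simpa [circleChar_apply, dilationPow, inner_self_eq_norm_sq_to_K] using this
  · have h0 : (fun z => T (E z) - (z : ℂ) • E z) =ᵐ[σ] 0 := by
      refine ae_eq_zero_of_forall_dual ℂ fun y' => ?_
      -- The Koopman operator maps the functional `y'` to the functional `y' ∘L T`, so the
      -- intertwining relation for `J` can be read on `E`.
      have hV : koopman hT ((hμ.memLp_dual y').toLp y') =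
          (hμ.memLp_dual (y' ∘L T)).toLp (y' ∘L T) := rfl
      have h1 := hJV ((hμ.memLp_dual y').toLp y')
      rw [hV] at h1
      filter_upwards [h1, hE y', hE (y' ∘L T)] with z h1 h2 h3
      rw [← h3, ← h2] at h1
      simpa [sub_eq_zero] using h1
    filter_upwards [h0] with z hz using sub_eq_zero.1 hz
  · filter_upwards [hE y, hJ1] with z h1 h2
    rw [h1, h2]

end LinDyn

end

theorem proposition2p6 {X : Type*} [NormedAddCommGroup X] [NormedSpace ℂ X] [CompleteSpace X]
    [TopologicalSpace.SeparableSpace X] [MeasurableSpace X] [BorelSpace X]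
    (hX : LinDyn.HasCotypeTwo X) (S : Set (lp (fun _ : ℕ => ℂ) ∞)) (T : X →L[ℂ] X)
    (hT : LinDyn.IsSMixingGaussian S T) :
    LinDyn.IsPerfectlySpanningAnalytic (LinDyn.continuousMeasures S) T := by
  obtain ⟨μ, hμ, hopen, hTμ, hS⟩ := hT
  have := UniformSpace.secondCountable_of_separable X
  intro D _ hD
  refine LinDyn.dense_of_forall_dual_eq_zero _ fun y hy => ?_
  obtain ⟨σ, hσ, E, hmem, hmass, hTE, hyE⟩ := hμ.exists_eigenvector_field hX T hTμ y
  obtain ⟨D', hD'm, hDD', hD'0⟩ :=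
    hD _ (hS hmem) (LinDyn.isPositiveMeasure_complexOfMeasure σ)
  rw [LinDyn.complexOfMeasure_apply σ hD'm, Complex.ofReal_eq_zero,
    measureReal_eq_zero_iff] at hD'0
  -- Almost every `z` lies outside `D`, so `E z` lies in the span that `y` annihilates, against `y
  -- (E z) = 1`.
  have hfalse : ∀ᵐ z ∂σ, False := by
    filter_upwards [hTE, hyE, measure_eq_zero_iff_ae_notMem.1 hD'0] with z h1 h2 h3
    have h4 := hy (E z) (Submodule.subset_span (Set.mem_iUnion₂.2
      ⟨z, fun hz => h3 (hDD' hz), by simp [h1]⟩))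
    rw [h4] at h2
    exact zero_ne_one h2
  have hσ0 : σ = 0 := by
    rw [← ae_eq_bot]
    exact eventually_false_iff_eq_bot.1 hfalse
  have h0 : (hμ.memLp_dual y).toLp y = 0 := by
    rw [hσ0, measureReal_zero, Pi.zero_apply, Complex.ofReal_zero] at hmass
    exact norm_eq_zero.1 (Complex.ofReal_eq_zero.1 (pow_eq_zero_iff two_ne_zero |>.1 hmass.symm))
  rw [← (MemLp.zero' : MemLp (fun _ : X => (0 : ℂ)) 2 μ).toLp_zero, MemLp.toLp_eq_toLp_iff] at h0
  -- Full support enters here: continuous functions that agree almost everywhere agree everywhere.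
  have h1 := (y.continuous.ae_eq_iff_eq μ continuous_const).1 h0
  ext v
  exact congr_fun h1 v
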